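/- **Proposition.** Let $K$ be a simplicial complex on a set $\mathcal U$, that is, a collection of finite nonempty subsets of $\mathcal U$ such that every nonempty subset of an element of $K$ is in $K$. Let $X,Y\subset\mathcal U$ be such that $X\cup Y$ is the set of vertices of $K$ (the elements $v$ with $\{v\}\in K$), and put $A:=X\cap Y$. Write $K_X$ and $K_Y$ for the subcomplexes of all simplices of $K$ contained in $X$ and in $Y$ respectively, and $\mathrm{sk}_m K$ for the subcomplex of simplices with at most $m+1$ elements. Let $$P:=\{\sigma\in K\mid \sigma\subset X\ \text{ or }\ \sigma\subset Y\ \text{ or }\ \sigma\cap A\neq\emptyset\},$$ and for $\sigma\in K$ let $\mathrm{St}(\sigma,A):=\{\mu\subset A\mid \mu \text{ finite},\ \mu\neq\emptyset,\ \mu\cup\sigma\in K\}$, which is a (possibly empty) simplicial complex. Let $n\ge 0$ be an integer. If $\mathrm{St}(\sigma,A)$ is $n$-connected for every $\sigma\in(\mathrm{sk}_{n+1}K)\setminus P$, then the homotopy fibers of the inclusion $K_X\cup K_Y\subset K$, over every point of $K$, are $n$-connected. Here topological notions refer to the geometric realization $|K|$ with the weak topology; a space is $n$-connected if it is nonempty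 and its homotopy groups $\pi_i$ (for $i=0$, its set of path components) are trivial for all $0\le i\le n$ and every base point; and the homotopy fiber of $f\colon E\to B$ over $b\in B$ is the space of pairs $(e,\gamma)$ of a point $e\in E$ and a path $\gamma$ in $B$ from $f(e)$ to $b$. -/

import Mathlib

/-! Simplicial complexes on a universe `U` are Mathlib's `PreAbstractSimplicialComplex U`:
collections of finite nonempty subsets of `U` closed under nonempty subsets (an element of `U`
need not be a vertex). Union, intersection and inclusion of complexes are `⊔`, `⊓` and `≤`. -/

namespace PreAbstractSimplicialComplex

universe u

variable {U : Type u}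

/-- The set `K₀` of vertices of `K`. -/
def vertexSet (K : PreAbstractSimplicialComplex U) : Set U :=
  {v | ({v} : Finset U) ∈ K}

/-- The restriction `K_X`: the simplices of `K` that are subsets of `X`. -/
def restriction (K : PreAbstractSimplicialComplex U) (X : Set U) :
    PreAbstractSimplicialComplex U where
  faces := {σ | σ ∈ K ∧ (σ : Set U) ⊆ X}
  isRelLowerSet_faces := fun _ hσ =>
    ⟨(K.isRelLowerSet_faces hσ.1).1, fun _ hτσ hτ =>
      ⟨(K.isRelLowerSet_faces hσ.1).2 hτσ hτ, (Finset.coe_subset.2 hτσ).trans hσ.2⟩⟩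

/-- The skeleton `sk_m K`: the simplices of `K` of dimension at most `m`, that is, with at most
`m + 1` elements. -/
def skeleton (K : PreAbstractSimplicialComplex U) (m : ℕ) :
    PreAbstractSimplicialComplex U where
  faces := {σ | σ ∈ K ∧ σ.card ≤ m + 1}
  isRelLowerSet_faces := fun _ hσ =>
    ⟨(K.isRelLowerSet_faces hσ.1).1, fun _ hτσ hτ =>
      ⟨(K.isRelLowerSet_faces hσ.1).2 hτσ hτ, (Finset.card_le_card hτσ).trans hσ.2⟩⟩

open Classical in
/-- The obstruction complex `St(σ, A)`: the nonempty finite `μ ⊆ A` with `μ ∪ σ ∈ K`. -/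
def obstruction (K : PreAbstractSimplicialComplex U) (σ : Finset U) (A : Set U) :
    PreAbstractSimplicialComplex U where
  faces := {μ | (μ : Set U) ⊆ A ∧ μ.Nonempty ∧ μ ∪ σ ∈ K}
  isRelLowerSet_faces := fun _ hμ =>
    ⟨hμ.2.1, fun _ hτμ hτ =>
      ⟨(Finset.coe_subset.2 hτμ).trans hμ.1, hτ,
        (K.isRelLowerSet_faces hμ.2.2).2 (Finset.union_subset_union_left hτμ)
          (hτ.mono Finset.subset_union_left)⟩⟩

/-- The poset `P` of the simplices `σ` of `K` with `σ ⊆ X`, or `σ ⊆ Y`, or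
`σ ∩ (X ∩ Y) ≠ ∅`. -/
def decompositionPoset (K : PreAbstractSimplicialComplex U) (X Y : Set U) : Set (Finset U) :=
  {σ | σ ∈ K ∧
    ((σ : Set U) ⊆ X ∨ (σ : Set U) ⊆ Y ∨ ((σ : Set U) ∩ (X ∩ Y)).Nonempty)}

/-- The points of the geometric realization `|K|`, in barycentric coordinates: functions
`w ≥ 0` on `U` that vanish outside some simplex `σ` of `K` and sum to `1` over it. -/
@[ext]
structure Realization (K : PreAbstractSimplicialComplex U) : Type u where
  coord : U → ℝ
  coord_nonneg : ∀ v, 0 ≤ coord v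
  exists_simplex : ∃ σ ∈ K, (∀ v, v ∉ σ → coord v = 0) ∧ ∑ v ∈ σ, coord v = 1

open Classical in
/-- The inclusion in `|K|` of the closed simplex spanned by `σ ∈ K`. -/
noncomputable def faceInclusion (K : PreAbstractSimplicialComplex U) (σ : {σ : Finset U // σ ∈ K})
    (t : stdSimplex ℝ {v // v ∈ σ.1}) : K.Realization where
  coord v := if h : v ∈ σ.1 then t.1 ⟨v, h⟩ else 0
  coord_nonneg v := by
    split_ifs with h
    · exact t.2.1 _
    · exact le_rfl
  exists_simplex := by
    refine ⟨σ.1, σ.2, fun v hv => dif_neg hv, ?_⟩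
    rw [← Finset.sum_attach, ← t.2.2, Finset.univ_eq_attach]
    exact Finset.sum_congr rfl fun v _ => dif_pos v.2

/-- The weak topology on `|K|`: a set is open if and only if its trace on every closed simplex
is open. -/
noncomputable instance (K : PreAbstractSimplicialComplex U) : TopologicalSpace K.Realization :=
  ⨆ σ : {σ : Finset U // σ ∈ K}, TopologicalSpace.coinduced (K.faceInclusion σ) inferInstance

/-- The map `|L| → |K|` induced by the inclusion of a subcomplex `L ⊆ K`. -/
def realizationInclusion {L K : PreAbstractSimplicialComplex U} (h : L ≤ K) :
    C(L.Realization, K.Realization) where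
  toFun w := ⟨w.coord, w.coord_nonneg, w.exists_simplex.imp fun _ hσ => ⟨h hσ.1, hσ.2⟩⟩
  continuous_toFun := by
    refine continuous_iSup_dom.2 fun σ => continuous_coinduced_dom.2 ?_
    exact continuous_iff_coinduced_le.2 (le_iSup (fun σ : {σ : Finset U // σ ∈ K} =>
      TopologicalSpace.coinduced (K.faceInclusion σ) inferInstance) ⟨σ.1, h σ.2⟩)

/-- `K_X ∪ K_Y` is a subcomplex of `K`. -/
theorem restriction_sup_restriction_le (K : PreAbstractSimplicialComplex U) (X Y : Set U) :
    K.restriction X ⊔ K.restriction Y ≤ K :=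
  sup_le (fun _ h => h.1) (fun _ h => h.1)

end PreAbstractSimplicialComplex

/-- A space is `n`-connected if it is nonempty and, for every choice of base point, its homotopy
groups (its set of path components, for `i = 0`) in degrees `0, …, n` are trivial. -/
def IsNConnected (n : ℕ) (Z : Type*) [TopologicalSpace Z] : Prop :=
  Nonempty Z ∧ ∀ i ≤ n, ∀ z : Z, Subsingleton (HomotopyGroup.Pi i Z z)

/-- The homotopy fiber of `f` over `b`: pairs of a point `a` and a path from `f a` to `b`, with
the topology of a subspace of the product (the path space has the compact-open topology). -/
abbrev HomotopyFiber {E B : Type*} [TopologicalSpace E] [TopologicalSpace B]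
    (f : C(E, B)) (b : B) : Type _ :=
  {p : E × C(unitInterval, B) // p.2 0 = f p.1 ∧ p.2 1 = b}

/-! Write `A = X ∩ Y` and `L = K_X ∪ K_Y`. A map from a cube to the homotopy fiber is a map from a
prism to `|K|` whose bottom lies in `|L|` and whose top is the base point. So it suffices to deform
maps of the `j`-ball to `|K|`, `j ≤ n + 1`, into `|L|` while points already in `|L|` stay there
(`IsMapOn.exists_deformation`); `IsMapOn.exists_extension_prism` turns this into the lifting needed
for the fiber.

The deformation works pointwise on barycentric coordinates. A fine partition of unity of
multiplicity at most `j + 1` replaces the map by one with at most `n + 2` nonzero coordinates and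
smaller supports (`exists_skeletal`), and small coordinates are then cut off (`exists_threshold`). A
support `R` that lies in neither `X` nor `Y` has to be joined to `A`, that is, a point of `|St(R,
A)|` has to be chosen continuously. Since `St` reverses inclusions, these complexes form a monotone
carrier on the nerve of a second partition of unity. They are `n`-connected by hypothesis, or cones
if `R` meets `A`, so a map on the `(n + 1)`-skeleton of the nerve is built simplex by simplex
(`exists_isMapOn_of_carrier`, `exists_joinable`). Finally mass is taken from the vertices outside
`X` and outside `Y` until one of the two kinds is used up, and is given to the chosen point over `A`
(`exists_push`); the result is supported in `X` or in `Y`. -/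

section

/-! ### Points of realizations and maps from compact sets, in coordinates. -/

namespace PreAbstractSimplicialComplex

open Set Topology

variable {U : Type*} {M N : PreAbstractSimplicialComplex U}

/-- `w` is the family of barycentric coordinates of a point of `|M|`. -/
def IsPoint (M : PreAbstractSimplicialComplex U) (w : U → ℝ) : Prop :=
  (∀ v, 0 ≤ w v) ∧ ∃ σ ∈ M, (∀ v, v ∉ σ → w v = 0) ∧ ∑ v ∈ σ, w v = 1

theorem mem_of_subset {σ τ : Finset U} (hσ : σ ∈ M) (h : τ ⊆ σ) (hτ : τ.Nonempty) : τ ∈ M :=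
  (M.isRelLowerSet_faces hσ).2 h hτ

theorem Realization.isPoint (w : M.Realization) : M.IsPoint w.coord :=
  ⟨w.coord_nonneg, w.exists_simplex⟩

theorem isPoint_coord {w : U → ℝ} (h : M.IsPoint w) : ∃ x : M.Realization, x.coord = w :=
  ⟨⟨w, h.1, h.2⟩, rfl⟩

namespace IsPoint

variable {w w' : U → ℝ}

theorem mono (h : M.IsPoint w) (hMN : M ≤ N) : N.IsPoint w :=
  ⟨h.1, h.2.imp fun _ hσ => ⟨hMN hσ.1, hσ.2⟩⟩

theorem sum_eq_one (h : M.IsPoint w) {S : Finset U} (hS : ∀ v, v ∉ S → w v = 0) :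
    ∑ v ∈ S, w v = 1 := by
  classical
  obtain ⟨σ, -, h0, h1⟩ := h.2
  rw [← h1, Finset.sum_subset (Finset.subset_union_left (s₂ := σ)) fun v _ hv => hS v hv,
    ← Finset.sum_subset (Finset.subset_union_right (s₁ := S)) fun v _ hv => h0 v hv]

theorem le_one (h : M.IsPoint w) (v : U) : w v ≤ 1 := by
  obtain ⟨σ, -, h0, h1⟩ := h.2
  by_cases hv : v ∈ σ
  · exact h1 ▸ Finset.single_le_sum (fun v _ => h.1 v) hv
  · rw [h0 v hv]; exact zero_le_one

theorem exists_ne_zero (h : M.IsPoint w) : ∃ v, w v ≠ 0 := by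
  obtain ⟨σ, -, -, h1⟩ := h.2
  obtain ⟨v, -, hv⟩ := Finset.exists_ne_zero_of_sum_ne_zero (h1 ▸ one_ne_zero)
  exact ⟨v, hv⟩

/-- Any nonempty finite set of vertices with nonzero coordinates is a simplex. -/
theorem mem_of_ne_zero (h : M.IsPoint w) {τ : Finset U} (hτ : τ.Nonempty)
    (h0 : ∀ v ∈ τ, w v ≠ 0) : τ ∈ M := by
  obtain ⟨σ, hσ, h1, -⟩ := h.2
  exact mem_of_subset hσ (fun v hv => by_contra fun hv' => h0 v hv (h1 v hv')) hτ

theorem of_sum_eq_one {S σ : Finset U} (h0 : ∀ v, 0 ≤ w v) (hS : ∀ v, v ∉ S → w v = 0)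
    (h1 : ∑ v ∈ S, w v = 1) (hσ : σ ∈ M) (hwσ : ∀ v, w v ≠ 0 → v ∈ σ) : M.IsPoint w := by
  classical
  refine ⟨h0, σ, hσ, fun v hv => by_contra fun h => hv (hwσ v h), ?_⟩
  rw [← h1, Finset.sum_subset (Finset.subset_union_left (s₂ := σ)) fun v _ hv => hS v hv,
    ← Finset.sum_subset (Finset.subset_union_right (s₁ := S))
      fun v _ hv => by_contra fun h => hv (hwσ v h)]

/-- The support of a point is a simplex. -/
theorem exists_support (h : M.IsPoint w) : ∃ σ ∈ M, ∀ v, v ∈ σ ↔ w v ≠ 0 := by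
  classical
  obtain ⟨σ, -, h1, -⟩ := id h.2
  have key : ∀ v, v ∈ σ.filter (fun v => w v ≠ 0) ↔ w v ≠ 0 := fun v => by
    rw [Finset.mem_filter]
    exact ⟨fun h => h.2, fun h => ⟨by_contra fun hv => h (h1 v hv), h⟩⟩
  refine ⟨_, h.mem_of_ne_zero ?_ fun v hv => (key v).1 hv, key⟩
  obtain ⟨v, hv⟩ := h.exists_ne_zero
  exact ⟨v, (key v).2 hv⟩

/-- A point of `|N|` whose support lies in the support of a point of `|M|` is a point of `|M|`. -/
theorem of_support_subset (h : M.IsPoint w) (h' : N.IsPoint w')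
    (hw : ∀ v, w' v ≠ 0 → w v ≠ 0) : M.IsPoint w' := by
  obtain ⟨σ, hσ, hσ'⟩ := h.exists_support
  obtain ⟨τ, -, h0, h1⟩ := h'.2
  exact of_sum_eq_one h'.1 h0 h1 hσ fun v hv => (hσ' v).2 (hw v hv)

theorem combo (h : M.IsPoint w) (h' : N.IsPoint w') {K : PreAbstractSimplicialComplex U}
    {σ : Finset U} (hσ : σ ∈ K) (hw : ∀ v, w v ≠ 0 → v ∈ σ) (hw' : ∀ v, w' v ≠ 0 → v ∈ σ)
    {s : ℝ} (hs : s ∈ Icc (0 : ℝ) 1) : K.IsPoint fun v => (1 - s) * w v + s * w' v := by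
  have a : ∀ v, v ∉ σ → w v = 0 := fun v hv => by_contra fun h => hv (hw v h)
  have a' : ∀ v, v ∉ σ → w' v = 0 := fun v hv => by_contra fun h => hv (hw' v h)
  refine ⟨fun v => add_nonneg (mul_nonneg (by linarith [hs.2]) (h.1 v)) (mul_nonneg hs.1 (h'.1 v)),
    σ, hσ, fun v hv => by simp [a v hv, a' v hv], ?_⟩
  rw [Finset.sum_add_distrib, ← Finset.mul_sum, ← Finset.mul_sum, h.sum_eq_one a,
    h'.sum_eq_one a']
  ring

open Classical in
theorem single {a : U} (h : ({a} : Finset U) ∈ M) : M.IsPoint fun v => if v = a then 1 else 0 :=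
  ⟨fun v => by beta_reduce; split_ifs <;> norm_num, {a}, h, fun v hv => by simpa using hv, by simp⟩

end IsPoint

theorem continuous_coord (v : U) : Continuous fun w : M.Realization => w.coord v := by
  refine continuous_iSup_dom.2 fun σ => continuous_coinduced_dom.2 ?_
  by_cases h : v ∈ σ.1
  · simpa [Function.comp_def, faceInclusion, h] using
      (continuous_apply _).comp continuous_subtype_val
  · simpa [Function.comp_def, faceInclusion, h] using continuous_const

theorem faceInclusion_injective (σ : {σ : Finset U // σ ∈ M}) :
    Function.Injective (M.faceInclusion σ) := by
  intro t t' h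
  refine Subtype.ext (funext fun v => ?_)
  have := congrFun (congrArg Realization.coord h) v.1
  simpa [faceInclusion] using this

theorem exists_faceInclusion_eq (w : M.Realization) (σ : {σ : Finset U // σ ∈ M})
    (h : ∀ v, v ∉ σ.1 → w.coord v = 0) :
    ∃ t, M.faceInclusion σ t = w ∧ ∀ v, t.1 v = w.coord v := by
  refine ⟨⟨fun v => w.coord v, fun v => w.coord_nonneg v, ?_⟩, ?_, fun v => rfl⟩
  · rw [Finset.univ_eq_attach, Finset.sum_attach σ.1 w.coord]
    exact w.isPoint.sum_eq_one h
  · ext v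
    by_cases hv : v ∈ σ.1
    · simp [faceInclusion, hv]
    · simp [faceInclusion, hv, h v hv]

/-- A compact subset of `|M|` meets only finitely many open stars of vertices. -/
theorem exists_finset_of_isCompact {C : Set M.Realization} (hC : IsCompact C) :
    ∃ S : Finset U, ∀ w ∈ C, ∀ v, v ∉ S → w.coord v = 0 := by
  classical
  have key : ∀ v : {v : U // ∃ w ∈ C, w.coord v ≠ 0}, ∃ w ∈ C, w.coord v.1 ≠ 0 := fun v => v.2
  choose p hp hp0 using key
  -- A closed simplex contains only finitely many of the chosen points, so any set of them is closed
  -- in the weak topology. Omitting finitely many and taking complements gives a directed open cover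
  -- of `C`.
  have hclosed : ∀ V : Set {v : U // ∃ w ∈ C, w.coord v ≠ 0}, IsClosed (p '' V) := by
    intro V
    refine isClosed_iSup_iff.2 fun σ => isClosed_coinduced.2 (Set.Finite.isClosed ?_)
    have hfin : (M.faceInclusion σ ⁻¹' (p '' {v | v.1 ∈ σ.1})).Finite := by
      refine Set.Finite.preimage (faceInclusion_injective σ).injOn (Set.Finite.image _ ?_)
      exact Set.Finite.preimage Subtype.val_injective.injOn σ.1.finite_toSet
    refine hfin.subset ?_
    rintro t ⟨v, -, hv⟩
    refine ⟨v, ?_, hv⟩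
    by_contra hvσ
    apply hp0 v
    rw [hv]
    simp only [mem_ofPred_eq] at hvσ
    simp [faceInclusion, hvσ]
  obtain ⟨T, hT⟩ := hC.elim_directed_cover
    (fun T : Finset {v : U // ∃ w ∈ C, w.coord v ≠ 0} => (p '' {v | v ∉ T})ᶜ)
    (fun T => (hclosed _).isOpen_compl) (by
      intro w hw
      obtain ⟨σ, hσ, h0, -⟩ := w.exists_simplex
      refine mem_iUnion.2 ⟨σ.subtype _, ?_⟩
      rintro ⟨v, hv, rfl⟩
      exact hp0 v (h0 _ fun h => hv (Finset.mem_subtype.2 h)))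
    (by
      intro T T'
      refine ⟨T ∪ T', ?_, ?_⟩ <;>
      · refine compl_subset_compl.2 (image_mono fun v hv h => hv ?_)
        simp [h])
  refine ⟨T.map (Function.Embedding.subtype _), fun w hw v hv => by_contra fun h => ?_⟩
  refine hT (hp ⟨v, w, hw, h⟩) ⟨_, fun hmem => hv ?_, rfl⟩
  exact Finset.mem_map.2 ⟨_, hmem, rfl⟩

/-- The family `f` of coordinates describes a continuous map `s → |M|` with image in a finite
subcomplex. -/
structure IsMapOn {E : Type*} [TopologicalSpace E] (M : PreAbstractSimplicialComplex U)
    (s : Set E) (f : E → U → ℝ) : Prop where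
  exists_finset : ∃ S : Finset U, ∀ x ∈ s, ∀ v, v ∉ S → f x v = 0
  continuousOn : ∀ v, ContinuousOn (fun x => f x v) s
  isPoint : ∀ x ∈ s, M.IsPoint (f x)

namespace IsMapOn

variable {E F : Type*} [TopologicalSpace E] [TopologicalSpace F] {s t : Set E} {f g : E → U → ℝ}

theorem subset (h : M.IsMapOn s f) (hts : t ⊆ s) : M.IsMapOn t f :=
  ⟨h.1.imp fun _ hS x hx => hS x (hts hx), fun v => (h.2 v).mono hts, fun x hx => h.3 x (hts hx)⟩

theorem mono (h : M.IsMapOn s f) (hMN : M ≤ N) : N.IsMapOn s f :=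
  ⟨h.1, h.2, fun x hx => (h.3 x hx).mono hMN⟩

theorem change (h : M.IsMapOn s f) (hN : ∀ x ∈ s, N.IsPoint (f x)) : N.IsMapOn s f :=
  ⟨h.1, h.2, hN⟩

theorem congr (h : M.IsMapOn s f) (hfg : ∀ x ∈ s, g x = f x) : M.IsMapOn s g :=
  ⟨h.1.imp fun _ hS x hx v hv => by rw [hfg x hx, hS x hx v hv],
    fun v => (h.2 v).congr fun x hx => by rw [hfg x hx], fun x hx => by
      rw [hfg x hx]; exact h.3 x hx⟩

theorem comp (h : M.IsMapOn s f) {t : Set F} {φ : F → E} (hφ : ContinuousOn φ t)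
    (hmaps : MapsTo φ t s) : M.IsMapOn t fun y => f (φ y) :=
  ⟨h.1.imp fun _ hS _ hy => hS _ (hmaps hy), fun v => (h.2 v).comp hφ hmaps,
    fun _ hy => h.3 _ (hmaps hy)⟩

theorem union (hs : M.IsMapOn s f) (ht : M.IsMapOn t f) (hsc : IsClosed s) (htc : IsClosed t) :
    M.IsMapOn (s ∪ t) f := by
  classical
  obtain ⟨S, hS⟩ := hs.1
  obtain ⟨T, hT⟩ := ht.1
  refine ⟨⟨S ∪ T, ?_⟩, fun v => (hs.2 v).union_of_isClosed (ht.2 v) hsc htc, ?_⟩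
  · rintro x (hx | hx) v hv
    · exact hS x hx v fun h => hv (Finset.mem_union_left _ h)
    · exact hT x hx v fun h => hv (Finset.mem_union_right _ h)
  · rintro x (hx | hx)
    · exact hs.3 x hx
    · exact ht.3 x hx

/-- Straight-line homotopy with variable parameter. -/
theorem combo (hf : M.IsMapOn s f) (hg : N.IsMapOn s g) {K : PreAbstractSimplicialComplex U}
    {r : E → ℝ} (hr : ContinuousOn r s) (hr' : MapsTo r s (Icc 0 1))
    (h : ∀ x ∈ s, ∃ σ ∈ K, (∀ v, f x v ≠ 0 → v ∈ σ) ∧ ∀ v, g x v ≠ 0 → v ∈ σ) :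
    K.IsMapOn s fun x v => (1 - r x) * f x v + r x * g x v := by
  classical
  obtain ⟨S, hS⟩ := hf.1
  obtain ⟨T, hT⟩ := hg.1
  refine ⟨⟨S ∪ T, fun x hx v hv => ?_⟩, fun v => ?_, fun x hx => ?_⟩
  · rw [hS x hx v fun h => hv (Finset.mem_union_left _ h),
      hT x hx v fun h => hv (Finset.mem_union_right _ h)]
    simp
  · exact ((continuousOn_const.sub hr).mul (hf.2 v)).add (hr.mul (hg.2 v))
  · obtain ⟨σ, hσ, h1, h2⟩ := h x hx
    exact (hf.3 x hx).combo (hg.3 x hx) hσ h1 h2 (hr' hx)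

/-- Only the finitely many simplices inside `S` matter. Their preimages form a finite closed cover
of `s`, and on each of them the map factors through a single closed simplex. -/
theorem continuousOn_realization (h : M.IsMapOn s f) {φ : E → M.Realization}
    (hφ : ∀ x ∈ s, (φ x).coord = f x) : ContinuousOn φ s := by
  classical
  obtain ⟨S, hS⟩ := h.1
  rw [continuousOn_iff_continuous_domRestrict]
  let ι := {σ : Finset U // σ ∈ M ∧ σ ⊆ S}
  have : Finite ι := Finite.of_injective
    (fun σ : ι => (⟨σ.1, Finset.mem_powerset.2 σ.2.2⟩ : {σ // σ ∈ S.powerset}))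
    fun σ τ h => Subtype.ext (congrArg (fun x => x.1) h)
  refine (locallyFinite_of_finite
    fun σ : ι => {x : s | ∀ v, v ∉ σ.1 → f x v = 0}).continuous ?_ ?_ ?_
  · refine eq_univ_of_forall fun x => mem_iUnion.2 ?_
    obtain ⟨σ, hσ, h1⟩ := (h.3 x x.2).exists_support
    refine ⟨⟨σ, hσ, fun v hv => by_contra fun hvS => (h1 v).1 hv (hS x x.2 v hvS)⟩, ?_⟩
    exact fun v hv => by_contra fun h0 => hv ((h1 v).2 h0)
  · intro σ
    simp only [ofPred_forall]
    exact isClosed_iInter fun v => isClosed_iInter fun _ =>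
      isClosed_eq ((h.2 v).comp_continuous continuous_subtype_val fun x => x.2) continuous_const
  · intro σ
    rw [continuousOn_iff_continuous_domRestrict]
    have hex : ∀ x : {x : s | ∀ v, v ∉ σ.1 → f x v = 0}, ∃ t,
        M.faceInclusion ⟨σ.1, σ.2.1⟩ t = φ x ∧ ∀ v, t.1 v = f x v := by
      intro x
      rw [← hφ x.1 x.1.2]
      exact exists_faceInclusion_eq _ _ fun v hv => by rw [hφ x.1 x.1.2]; exact x.2 v hv
    choose τ hτ hτ' using hex
    have hτc : Continuous τ := by
      refine Continuous.subtype_mk (f := fun x => (τ x).1) (continuous_pi fun v => ?_) _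
      simp only [hτ']
      exact ((h.2 v).comp_continuous (f := fun x : {x : s | ∀ v, v ∉ σ.1 → f x v = 0} => x.1.1)
        (continuous_subtype_val.comp continuous_subtype_val) fun x => x.1.2)
    have hface : Continuous (M.faceInclusion ⟨σ.1, σ.2.1⟩) :=
      continuous_iff_coinduced_le.2 (le_iSup (fun σ : {σ : Finset U // σ ∈ M} =>
        TopologicalSpace.coinduced (M.faceInclusion σ) inferInstance) ⟨σ.1, σ.2.1⟩)
    exact (hface.comp hτc).congr hτ

end IsMapOn

/-- Compactness puts the image in a finite subcomplex; from here on the weak topology can be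
replaced by continuity of coordinates. -/
theorem isMapOn_coord {E : Type*} [TopologicalSpace E] {s : Set E} (hs : IsCompact s)
    {φ : E → M.Realization} (hφ : ContinuousOn φ s) : M.IsMapOn s fun x => (φ x).coord := by
  obtain ⟨S, hS⟩ := exists_finset_of_isCompact (hs.image_of_continuousOn hφ)
  exact ⟨⟨S, fun x hx => hS _ (mem_image_of_mem _ hx)⟩,
    fun v => (continuous_coord v).comp_continuousOn hφ, fun x _ => (φ x).isPoint⟩

end PreAbstractSimplicialComplex

end

/-! ### Extension over balls and simplices from triviality of homotopy groups. -/

section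

open Set Topology unitInterval

/-- The gauge `‖x‖ + |t|` on `ℝⁱ × ℝ`. -/
def suspensionNorm {i : ℕ} (z : (Fin i → ℝ) × ℝ) : ℝ := ‖z.1‖ + |z.2|

section suspensionNorm

variable {i : ℕ}

theorem continuous_suspensionNorm : Continuous (suspensionNorm (i := i)) := by
  unfold suspensionNorm; fun_prop

theorem suspensionNorm_nonneg (z : (Fin i → ℝ) × ℝ) : 0 ≤ suspensionNorm z := by
  unfold suspensionNorm; positivity

theorem suspensionNorm_smul {c : ℝ} (hc : 0 ≤ c) (z : (Fin i → ℝ) × ℝ) :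
    suspensionNorm (c • z) = c * suspensionNorm z := by
  simp [suspensionNorm, norm_smul, abs_mul, abs_of_nonneg hc, mul_add]

theorem eq_zero_of_suspensionNorm {z : (Fin i → ℝ) × ℝ} (h : suspensionNorm z = 0) : z = 0 := by
  unfold suspensionNorm at h
  have h1 : ‖z.1‖ = 0 := by linarith [norm_nonneg z.1, abs_nonneg z.2]
  have h2 : |z.2| = 0 := by linarith [norm_nonneg z.1, abs_nonneg z.2]
  exact Prod.ext (norm_eq_zero.1 h1) (abs_eq_zero.1 h2)

/-- The unit cube, recentred to `[-1, 1]ⁱ`. -/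
def cubeCenter (y : Fin i → I) : Fin i → ℝ := fun j => 2 * (y j : ℝ) - 1

theorem continuous_cubeCenter : Continuous (cubeCenter (i := i)) := by
  unfold cubeCenter; fun_prop

theorem norm_cubeCenter_le (y : Fin i → I) : ‖cubeCenter y‖ ≤ 1 := by
  refine (pi_norm_le_iff_of_nonneg zero_le_one).2 fun j => ?_
  rw [Real.norm_eq_abs, abs_le, cubeCenter]
  constructor <;> linarith [(y j).2.1, (y j).2.2]

theorem cubeCenter_injective : Function.Injective (cubeCenter (i := i)) := by
  intro y y' h
  funext j
  have := congrFun h j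
  simp only [cubeCenter] at this
  exact Subtype.ext (by linarith)

theorem exists_cubeCenter_eq {c : Fin i → ℝ} (hc : ‖c‖ ≤ 1) : ∃ y, cubeCenter y = c := by
  have h : ∀ j, |c j| ≤ 1 := fun j => (norm_le_pi_norm c j).trans hc
  refine ⟨fun j => ⟨(c j + 1) / 2, ?_⟩, ?_⟩
  · have := abs_le.1 (h j)
    constructor <;> linarith
  · funext j
    simp only [cubeCenter]
    ring

theorem norm_cubeCenter_eq_one {y : Fin i → I} : ‖cubeCenter y‖ = 1 ↔ y ∈ Cube.boundary (Fin i) := by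
  have hj : ∀ j, |2 * (y j : ℝ) - 1| = 1 ↔ y j = 0 ∨ y j = 1 := by
    intro j
    rw [abs_eq zero_le_one, ← Subtype.coe_inj, ← Subtype.coe_inj, or_comm]
    refine or_congr ⟨fun h => ?_, fun h => ?_⟩ ⟨fun h => ?_, fun h => ?_⟩
    · simp only [Set.Icc.coe_zero]; linarith
    · simp only [Set.Icc.coe_zero] at h; linarith
    · simp only [Set.Icc.coe_one]; linarith
    · simp only [Set.Icc.coe_one] at h; linarith
  constructor
  · intro h
    by_contra hb
    have : ‖cubeCenter y‖ < 1 := by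
      refine (pi_norm_lt_iff zero_lt_one).2 fun j => lt_of_le_of_ne ?_ fun h1 => hb ⟨j, (hj j).1 h1⟩
      exact (norm_le_pi_norm _ j).trans (norm_cubeCenter_le y)
    exact this.ne h
  · rintro ⟨j, h⟩
    refine le_antisymm (norm_cubeCenter_le y) ?_
    rw [← (hj j).2 h]
    exact norm_le_pi_norm (cubeCenter y) j

/-- The factor by which `cubeCollapse` scales a vector of norm `r`. -/
noncomputable def collapseFactor (r : ℝ) : ℝ := 2 * min 1 ((1 - r) / max r (1 / 2))

/-- The factor is `2` for `r ≤ 1/2` and `2(1 - r)/r` beyond; with last coordinate `2r - 1` the gauge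
of the collapsed point is then exactly `1`. -/
theorem collapseFactor_mul (r : ℝ) : collapseFactor r * r = 1 - |2 * r - 1| := by
  unfold collapseFactor
  rcases le_total r (1 / 2) with h | h
  · rw [max_eq_right h, min_eq_left, abs_of_nonpos (by linarith)]
    · ring
    · rw [le_div_iff₀ (by norm_num)]; linarith
  · rw [max_eq_left h, min_eq_right, abs_of_nonneg (by linarith)]
    · field_simp; ring
    · rw [div_le_one (by linarith)]; linarith

theorem collapseFactor_nonneg {r : ℝ} (h1 : r ≤ 1) : 0 ≤ collapseFactor r := by
  unfold collapseFactor
  have : 0 ≤ (1 - r) / max r (1 / 2) :=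
    div_nonneg (by linarith) (le_trans (by norm_num) (le_max_right _ _))
  positivity

theorem collapseFactor_pos {r : ℝ} (h1 : r < 1) : 0 < collapseFactor r := by
  unfold collapseFactor
  have : 0 < (1 - r) / max r (1 / 2) :=
    div_pos (by linarith) (lt_of_lt_of_le (by norm_num) (le_max_right _ _))
  positivity

/-- The collapse of the cube onto the unit sphere of `suspensionNorm`; it identifies the points
of the boundary of the cube with each other. -/
noncomputable def cubeCollapse (y : Fin i → I) : (Fin i → ℝ) × ℝ :=
  (collapseFactor ‖cubeCenter y‖ • cubeCenter y, 2 * ‖cubeCenter y‖ - 1)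

theorem continuous_cubeCollapse : Continuous (cubeCollapse (i := i)) := by
  have h := continuous_cubeCenter (i := i)
  have h' : ∀ y : Fin i → I, max ‖cubeCenter y‖ (1 / 2) ≠ 0 := fun y =>
    (lt_of_lt_of_le (by norm_num) (le_max_right _ _)).ne'
  unfold cubeCollapse collapseFactor
  fun_prop (disch := assumption)

theorem suspensionNorm_cubeCollapse (y : Fin i → I) : suspensionNorm (cubeCollapse y) = 1 := by
  have := collapseFactor_mul ‖cubeCenter y‖
  have h0 := collapseFactor_nonneg (norm_cubeCenter_le y)
  simp only [suspensionNorm, cubeCollapse, norm_smul, Real.norm_eq_abs, abs_of_nonneg h0]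
  linarith

theorem cubeCollapse_boundary {y : Fin i → I} (hy : y ∈ Cube.boundary (Fin i)) :
    cubeCollapse y = (0, 1) := by
  rw [cubeCollapse, norm_cubeCenter_eq_one.2 hy]
  norm_num [collapseFactor]

theorem cubeCollapse_eq {y y' : Fin i → I} (h : cubeCollapse y = cubeCollapse y') :
    y = y' ∨ y ∈ Cube.boundary (Fin i) ∧ y' ∈ Cube.boundary (Fin i) := by
  have h2 : ‖cubeCenter y‖ = ‖cubeCenter y'‖ := by
    have := congrArg Prod.snd h
    simp only [cubeCollapse] at this
    linarith
  rcases (norm_cubeCenter_le y).lt_or_eq with hlt | heq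
  · left
    have h1 := congrArg Prod.fst h
    simp only [cubeCollapse, ← h2] at h1
    exact cubeCenter_injective (smul_right_injective _ (collapseFactor_pos hlt).ne' h1)
  · exact Or.inr ⟨norm_cubeCenter_eq_one.1 heq, norm_cubeCenter_eq_one.1 (h2 ▸ heq)⟩

/-- For `i = 0` the cube is one point, sent to `(0, -1)`, and `(0, 1)` is missed; otherwise
`‖cubeCenter y‖` must be `(t + 1) / 2`. -/
theorem exists_cubeCollapse_eq (hi : i ≠ 0) {z : (Fin i → ℝ) × ℝ} (hz : suspensionNorm z = 1) :
    ∃ y, cubeCollapse y = z := by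
  obtain ⟨x, t⟩ := z
  simp only [suspensionNorm] at hz
  have : NeZero i := ⟨hi⟩
  have ht : |t| ≤ 1 := by linarith [norm_nonneg x]
  have ht' := abs_le.1 ht
  by_cases hx : x = 0
  · have ht1 : |t| = 1 := by simpa [hx] using hz
    rcases (abs_eq zero_le_one).1 ht1 with rfl | rfl
    · refine ⟨fun _ => 1, ?_⟩
      rw [cubeCollapse_boundary ⟨0, Or.inr rfl⟩, hx]
    · obtain ⟨y, hy⟩ := exists_cubeCenter_eq (c := (0 : Fin i → ℝ)) (by simp)
      refine ⟨y, ?_⟩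
      simp [cubeCollapse, hy, hx]
  · have hx0 : ‖x‖ ≠ 0 := norm_ne_zero_iff.2 hx
    have hr : 0 ≤ (t + 1) / 2 := by linarith
    have hn : ‖((t + 1) / 2 / ‖x‖) • x‖ = (t + 1) / 2 := by
      rw [norm_smul, Real.norm_of_nonneg (by positivity)]
      field_simp
    obtain ⟨y, hy⟩ := exists_cubeCenter_eq (c := ((t + 1) / 2 / ‖x‖) • x) (by rw [hn]; linarith)
    refine ⟨y, ?_⟩
    have hf := collapseFactor_mul ((t + 1) / 2)
    rw [cubeCollapse, hy, hn, smul_smul, mul_div_assoc', hf]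
    have h2 : 2 * ((t + 1) / 2) - 1 = t := by ring
    rw [h2, show 1 - |t| = ‖x‖ by linarith, div_self hx0, one_smul]

/-- If `π_i(Z)` is trivial at all base points, `i ≥ 1`, then maps to `Z` from the `i`-sphere extend
to the ball. -/
theorem exists_extension_ball {Z : Type*} [TopologicalSpace Z] (hi : i ≠ 0)
    (hZ : ∀ z : Z, Subsingleton (HomotopyGroup.Pi i Z z)) {f : (Fin i → ℝ) × ℝ → Z}
    (hf : ContinuousOn f {z | suspensionNorm z = 1}) :
    ∃ F : (Fin i → ℝ) × ℝ → Z, ContinuousOn F {z | suspensionNorm z ≤ 1} ∧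
      ∀ z, suspensionNorm z = 1 → F z = f z := by
  classical
  let ℓ : GenLoop (Fin i) Z (f (0, 1)) :=
    ⟨⟨fun y => f (cubeCollapse y),
      hf.comp_continuous continuous_cubeCollapse suspensionNorm_cubeCollapse⟩,
      fun y hy => congrArg f (cubeCollapse_boundary hy)⟩
  have hhom : GenLoop.Homotopic ℓ GenLoop.const :=
    Quotient.exact ((hZ (f (0, 1))).elim (⟦ℓ⟧ : HomotopyGroup.Pi i Z _) ⟦GenLoop.const⟧)
  obtain ⟨H⟩ := hhom
  have hp : ∀ a : I × (Fin i → I), suspensionNorm ((1 - (a.1 : ℝ)) • cubeCollapse a.2) = 1 - a.1 :=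
    fun a => by
      rw [suspensionNorm_smul (by linarith [a.1.2.2]), suspensionNorm_cubeCollapse, mul_one]
  -- The cylinder of the nullhomotopy collapses onto the ball, its end `s = 1` to the center. This
  -- is a quotient map (compact onto Hausdorff), and `H` is constant on its fibers because it is
  -- constant on the end and on the boundary of the cube.
  let p : C(I × (Fin i → I), {z : (Fin i → ℝ) × ℝ // suspensionNorm z ≤ 1}) :=
    ⟨fun a => ⟨(1 - (a.1 : ℝ)) • cubeCollapse a.2, by rw [hp]; linarith [a.1.2.1]⟩, by
      have := continuous_cubeCollapse (i := i)
      fun_prop⟩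
  have hps : Function.Surjective p := by
    rintro ⟨z, hz⟩
    by_cases h0 : suspensionNorm z = 0
    · refine ⟨(1, fun _ => 0), Subtype.ext ?_⟩
      simp [p, eq_zero_of_suspensionNorm h0]
    · have hn := suspensionNorm_nonneg z
      obtain ⟨y, hy⟩ := exists_cubeCollapse_eq hi (z := (suspensionNorm z)⁻¹ • z) (by
        rw [suspensionNorm_smul (by positivity)]; field_simp)
      refine ⟨(⟨1 - suspensionNorm z, by linarith, by linarith⟩, y), Subtype.ext ?_⟩
      simp [p, hy, smul_smul, h0]
  have hq : IsQuotientMap p := IsQuotientMap.of_surjective_continuous hps p.continuous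
  have hfac : Function.FactorsThrough H.toContinuousMap p := by
    rintro ⟨s, y⟩ ⟨s', y'⟩ h
    have h1 : (1 - (s : ℝ)) • cubeCollapse y = (1 - (s' : ℝ)) • cubeCollapse y' :=
      congrArg Subtype.val h
    have hs : s = s' := Subtype.ext (by
      have := hp (s, y)
      simp only [h1, hp (s', y')] at this
      linarith)
    subst hs
    change H (s, y) = H (s, y')
    by_cases h1s : s = 1
    · subst h1s
      rw [H.apply_one, H.apply_one]; rfl
    · have : (1 - (s : ℝ)) ≠ 0 := fun h => h1s (Subtype.ext (by rw [Set.Icc.coe_one]; linarith))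
      rcases cubeCollapse_eq (smul_right_injective _ this h1) with rfl | ⟨hy, hy'⟩
      · rfl
      · rw [H.eq_fst s hy, H.eq_fst s hy']
        change f _ = f _
        rw [cubeCollapse_boundary hy, cubeCollapse_boundary hy']
  let F := hq.lift H.toContinuousMap hfac
  have hF : ∀ a, F (p a) = H a := fun a =>
    congrFun (congrArg DFunLike.coe (hq.lift_comp H.toContinuousMap hfac)) a
  refine ⟨fun z => if h : suspensionNorm z ≤ 1 then F ⟨z, h⟩ else f (0, 1), ?_, fun z hz => ?_⟩
  · rw [continuousOn_iff_continuous_domRestrict]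
    exact F.continuous.congr fun z =>
      (dif_pos (c := suspensionNorm z.1 ≤ 1) (t := fun h => F ⟨z.1, h⟩) z.2).symm
  · simp only [hz, le_refl, dite_true]
    obtain ⟨y, rfl⟩ := exists_cubeCollapse_eq hi hz
    have := hF (0, y)
    rw [H.apply_zero] at this
    refine Eq.trans (congrArg F (Subtype.ext ?_)) this
    simp [p]

/-- The least coordinate of a vector. -/
noncomputable def minCoord {k : ℕ} (p : Fin (k + 1) → ℝ) : ℝ :=
  Finset.univ.inf' Finset.univ_nonempty p

theorem minCoord_le {k : ℕ} (p : Fin (k + 1) → ℝ) (j : Fin (k + 1)) : minCoord p ≤ p j :=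
  Finset.inf'_le p (Finset.mem_univ j)

theorem exists_eq_minCoord {k : ℕ} (p : Fin (k + 1) → ℝ) : ∃ j, p j = minCoord p := by
  obtain ⟨j, -, hj⟩ := Finset.exists_mem_eq_inf' Finset.univ_nonempty p
  exact ⟨j, hj.symm⟩

theorem continuous_minCoord {k : ℕ} : Continuous (minCoord (k := k)) :=
  Continuous.finset_inf'_apply _ fun j _ => continuous_apply j

theorem minCoord_eq {k : ℕ} {p : Fin (k + 1) → ℝ} {j : Fin (k + 1)} (h : ∀ j', p j ≤ p j') :
    minCoord p = p j :=
  le_antisymm (minCoord_le p j) (Finset.le_inf' _ _ fun j' _ => h j')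

theorem mul_minCoord_le {k : ℕ} {p : Fin (k + 1) → ℝ} (hp : p ∈ stdSimplex ℝ (Fin (k + 1))) :
    (k + 1) * minCoord p ≤ 1 := by
  have h := Finset.sum_le_sum fun (j : Fin (k + 1)) (_ : j ∈ Finset.univ) => minCoord_le p j
  rw [hp.2] at h
  simpa using h

theorem minCoord_nonneg {k : ℕ} {p : Fin (k + 1) → ℝ} (hp : p ∈ stdSimplex ℝ (Fin (k + 1))) :
    0 ≤ minCoord p := by
  obtain ⟨j, hj⟩ := exists_eq_minCoord p
  exact hj ▸ hp.1 j

/-- The boundary of the standard simplex. -/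
def simplexBoundary (k : ℕ) : Set (Fin (k + 1) → ℝ) :=
  {p | p ∈ stdSimplex ℝ (Fin (k + 1)) ∧ ∃ j, p j = 0}

theorem minCoord_of_mem_simplexBoundary {k : ℕ} {p : Fin (k + 1) → ℝ}
    (hp : p ∈ simplexBoundary k) : minCoord p = 0 := by
  obtain ⟨j, hj⟩ := hp.2
  exact le_antisymm (hj ▸ minCoord_le p j) (minCoord_nonneg hp.1)

/-- The vector with sum zero and given coordinates other than the second. -/
def zeroSumVector (z : (Fin i → ℝ) × ℝ) : Fin (i + 2) → ℝ :=
  Fin.cons z.2 (Fin.cons (-(z.2 + ∑ j, z.1 j)) z.1)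

theorem continuous_zeroSumVector : Continuous (zeroSumVector (i := i)) := by
  refine continuous_pi fun j => ?_
  refine Fin.cases ?_ (Fin.cases ?_ fun j => ?_) j <;> simp only [zeroSumVector, Fin.cons_zero,
    Fin.cons_succ] <;> fun_prop

theorem sum_zeroSumVector (z : (Fin i → ℝ) × ℝ) : ∑ j, zeroSumVector z j = 0 := by
  simp [zeroSumVector, Fin.sum_univ_succ]

theorem minCoord_zeroSumVector_neg {z : (Fin i → ℝ) × ℝ} (hz : z ≠ 0) :
    minCoord (zeroSumVector z) < 0 := by
  by_contra! h
  have h0 : ∀ j ∈ Finset.univ, zeroSumVector z j = 0 :=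
    (Finset.sum_eq_zero_iff_of_nonneg fun j _ => h.trans (minCoord_le _ j)).1
      (sum_zeroSumVector z)
  refine hz (Prod.ext (funext fun j => ?_) ?_)
  · simpa [zeroSumVector] using h0 j.succ.succ (Finset.mem_univ _)
  · simpa [zeroSumVector] using h0 0 (Finset.mem_univ _)

/-- Radial projection of the unit sphere of `suspensionNorm` to the boundary of the simplex. -/
noncomputable def sphereToSimplex (z : (Fin i → ℝ) × ℝ) : Fin (i + 2) → ℝ := fun j =>
  ((i : ℝ) + 2)⁻¹ + zeroSumVector z j / (-((i : ℝ) + 2) * minCoord (zeroSumVector z))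

theorem sphereToSimplex_mem {z : (Fin i → ℝ) × ℝ} (hz : suspensionNorm z = 1) :
    sphereToSimplex z ∈ simplexBoundary (i + 1) := by
  have hz0 : z ≠ 0 := by
    rintro rfl
    simp [suspensionNorm] at hz
  have hm := minCoord_zeroSumVector_neg hz0
  have hi : (0 : ℝ) < (i : ℝ) + 2 := by positivity
  have hg : 0 < -((i : ℝ) + 2) * minCoord (zeroSumVector z) := by nlinarith
  have hform : ∀ j, sphereToSimplex z j = (zeroSumVector z j - minCoord (zeroSumVector z)) /
      (-((i : ℝ) + 2) * minCoord (zeroSumVector z)) := fun j => by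
    have hm' := hm.ne
    simp only [sphereToSimplex]
    field_simp
    ring
  refine ⟨⟨fun j => ?_, ?_⟩, ?_⟩
  · rw [hform]
    exact div_nonneg (sub_nonneg.2 (minCoord_le _ j)) hg.le
  · simp only [sphereToSimplex, Finset.sum_add_distrib, ← Finset.sum_div, sum_zeroSumVector]
    simp
    field_simp
    ring
  · obtain ⟨j, hj⟩ := exists_eq_minCoord (zeroSumVector z)
    exact ⟨j, by rw [hform, hj]; simp⟩

theorem continuousOn_sphereToSimplex :
    ContinuousOn (sphereToSimplex (i := i)) {z | suspensionNorm z = 1} := by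
  have h1 := continuous_zeroSumVector (i := i)
  have h2 := continuous_minCoord.comp h1
  refine continuousOn_pi.2 fun j => continuousOn_const.add (ContinuousOn.div
    ((continuous_apply j).comp h1).continuousOn (continuous_const.mul h2).continuousOn ?_)
  intro z hz
  have hz0 : z ≠ 0 := by
    rintro rfl
    simp [suspensionNorm] at hz
  have hi : (0 : ℝ) < (i : ℝ) + 2 := by positivity
  exact mul_ne_zero (neg_ne_zero.2 hi.ne') (minCoord_zeroSumVector_neg hz0).ne

/-- The coordinates of a point of the simplex relative to the barycenter. -/
noncomputable def simplexCenter (p : Fin (i + 2) → ℝ) : (Fin i → ℝ) × ℝ :=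
  (fun j => p j.succ.succ - ((i : ℝ) + 2)⁻¹, p 0 - ((i : ℝ) + 2)⁻¹)

theorem zeroSumVector_smul_simplexCenter {p : Fin (i + 2) → ℝ}
    (hp : p ∈ stdSimplex ℝ (Fin (i + 2))) (c : ℝ) (j : Fin (i + 2)) :
    zeroSumVector (c • simplexCenter p) j = c * (p j - ((i : ℝ) + 2)⁻¹) := by
  have hi : (i : ℝ) + 2 ≠ 0 := by positivity
  refine Fin.cases ?_ (Fin.cases ?_ fun j => ?_) j
  · simp [zeroSumVector, simplexCenter]
  · have h := hp.2
    simp only [Fin.sum_univ_succ] at h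
    have h' : p (Fin.succ 0) = 1 - p 0 - ∑ j : Fin i, p j.succ.succ := by linarith
    simp only [zeroSumVector, simplexCenter, Fin.cons_succ, Fin.cons_zero, Prod.smul_fst,
      Prod.smul_snd, Pi.smul_apply, smul_eq_mul, ← Finset.mul_sum, Finset.sum_sub_distrib, h']
    simp
    field_simp
    ring
  · simp [zeroSumVector, simplexCenter]

/-- Radial map from the simplex to the unit ball of `suspensionNorm`. -/
noncomputable def simplexToBall (p : Fin (i + 2) → ℝ) : (Fin i → ℝ) × ℝ :=
  (max (suspensionNorm (simplexCenter p)) (minCoord p))⁻¹ • simplexCenter p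

/-- At the barycenter the gauge vanishes but `minCoord` is positive. On the boundary `minCoord` is
zero, so there the map is plain radial normalization. -/
theorem simplexToBall_denom_pos {p : Fin (i + 2) → ℝ} (hp : p ∈ stdSimplex ℝ (Fin (i + 2))) :
    0 < max (suspensionNorm (simplexCenter p)) (minCoord p) := by
  by_cases h : suspensionNorm (simplexCenter p) = 0
  · refine lt_max_of_lt_right ?_
    obtain ⟨j, hj⟩ := exists_eq_minCoord p
    have := zeroSumVector_smul_simplexCenter hp 1 j
    rw [eq_zero_of_suspensionNorm h] at this
    have h0 : zeroSumVector ((1 : ℝ) • (0 : (Fin i → ℝ) × ℝ)) j = 0 := by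
      refine Fin.cases ?_ (Fin.cases ?_ fun j => ?_) j <;> simp [zeroSumVector]
    rw [h0] at this
    have hi : (0 : ℝ) < ((i : ℝ) + 2)⁻¹ := by positivity
    linarith
  · exact lt_max_of_lt_left (lt_of_le_of_ne (suspensionNorm_nonneg _) (Ne.symm h))

theorem suspensionNorm_simplexToBall_le {p : Fin (i + 2) → ℝ}
    (hp : p ∈ stdSimplex ℝ (Fin (i + 2))) : suspensionNorm (simplexToBall p) ≤ 1 := by
  have h := simplexToBall_denom_pos hp
  rw [simplexToBall, suspensionNorm_smul (by positivity), inv_mul_le_iff₀ h, mul_one]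
  exact le_max_left _ _

theorem continuousOn_simplexToBall :
    ContinuousOn (simplexToBall (i := i)) (stdSimplex ℝ (Fin (i + 2))) := by
  have h1 : Continuous (simplexCenter (i := i)) := by unfold simplexCenter; fun_prop
  have h2 := continuous_suspensionNorm.comp h1
  exact ((h2.max continuous_minCoord).continuousOn.inv₀ fun p hp =>
    (simplexToBall_denom_pos hp).ne').smul h1.continuousOn

theorem suspensionNorm_simplexToBall {p : Fin (i + 2) → ℝ} (hp : p ∈ simplexBoundary (i + 1)) :
    suspensionNorm (simplexToBall p) = 1 := by
  have h := simplexToBall_denom_pos hp.1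
  have h' : max (suspensionNorm (simplexCenter p)) (minCoord p) =
      suspensionNorm (simplexCenter p) := by
    rw [minCoord_of_mem_simplexBoundary hp]
    exact max_eq_left (suspensionNorm_nonneg _)
  rw [h'] at h
  rw [simplexToBall, h', suspensionNorm_smul (by positivity), inv_mul_cancel₀ h.ne']

theorem sphereToSimplex_simplexToBall {p : Fin (i + 2) → ℝ} (hp : p ∈ simplexBoundary (i + 1)) :
    sphereToSimplex (simplexToBall p) = p := by
  have h := simplexToBall_denom_pos hp.1
  obtain ⟨j₀, hj₀⟩ := hp.2
  have hi : (i : ℝ) + 2 ≠ 0 := by positivity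
  have hm : minCoord (zeroSumVector (simplexToBall p)) =
      (max (suspensionNorm (simplexCenter p)) (minCoord p))⁻¹ * (p j₀ - ((i : ℝ) + 2)⁻¹) := by
    rw [simplexToBall, ← zeroSumVector_smul_simplexCenter hp.1]
    refine minCoord_eq fun j => ?_
    rw [zeroSumVector_smul_simplexCenter hp.1, zeroSumVector_smul_simplexCenter hp.1, hj₀]
    exact mul_le_mul_of_nonneg_left (by linarith [hp.1.1 j]) (by positivity)
  funext j
  rw [sphereToSimplex, hm, simplexToBall, zeroSumVector_smul_simplexCenter hp.1, hj₀]
  field_simp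
  ring

end suspensionNorm

/-- Maps from the boundary of the `k`-simplex to an `n`-connected space extend over the simplex,
for `k ≤ n + 1`. -/
theorem IsNConnected.exists_extension_simplex {Z : Type*} [TopologicalSpace Z] {n k : ℕ}
    (hZ : IsNConnected n Z) (hk : k ≤ n + 1) {f : (Fin (k + 1) → ℝ) → Z}
    (hf : ContinuousOn f (simplexBoundary k)) :
    ∃ F : (Fin (k + 1) → ℝ) → Z, ContinuousOn F (stdSimplex ℝ (Fin (k + 1))) ∧
      ∀ p ∈ simplexBoundary k, F p = f p := by
  obtain ⟨⟨z⟩, hZ⟩ := hZ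
  match k with
  -- The boundary of a point is empty, so only nonemptiness is needed.
  | 0 =>
    refine ⟨fun _ => z, continuousOn_const, fun p hp => ?_⟩
    obtain ⟨⟨-, h1⟩, j, hj⟩ := hp
    rw [show j = 0 from Fin.fin_one_eq_zero j] at hj
    simp [hj] at h1
  | 1 =>
    have : Subsingleton (ZerothHomotopy Z) :=
      (HomotopyGroup.pi0EquivZerothHomotopy (x := z)).subsingleton_congr.1 (hZ 0 (by omega) z)
    obtain ⟨γ⟩ : Joined (f ![1, 0]) (f ![0, 1]) := Quotient.exact (this.elim ⟦f ![1, 0]⟧ ⟦f ![0, 1]⟧)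
    refine ⟨fun p => γ.extend (p 1), (γ.continuous_extend.comp (continuous_apply 1)).continuousOn,
      fun p hp => ?_⟩
    obtain ⟨⟨-, h1⟩, j, hj⟩ := hp
    rw [Fin.sum_univ_two] at h1
    fin_cases j
    · have : p = ![0, 1] := by
        funext j
        fin_cases j
        · exact hj
        · simp at hj ⊢; linarith
      simp [this]
    · have : p = ![1, 0] := by
        funext j
        fin_cases j
        · simp at hj ⊢; linarith
        · exact hj
      simp [this]
  -- The boundary of the simplex is an `(i + 1)`-sphere, and going to the gauge sphere and back is
  -- the identity on it.
  | i + 2 =>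
    obtain ⟨F, hF, hFf⟩ := exists_extension_ball (i := i + 1) (by omega)
      (fun z => hZ (i + 1) (by omega) z)
      (hf.comp continuousOn_sphereToSimplex fun z hz => sphereToSimplex_mem hz)
    refine ⟨fun p => F (simplexToBall p), hF.comp continuousOn_simplexToBall fun p hp =>
      suspensionNorm_simplexToBall_le hp, fun p hp => ?_⟩
    beta_reduce
    rw [hFf _ (suspensionNorm_simplexToBall hp), Function.comp_apply,
      sphereToSimplex_simplexToBall hp]

end

/-! ### Filling simplices in a complex, and maps that follow a carrier. -/

section

open Set Topology

/-- At zeros of `a` nothing but boundedness of `b` nearby is available; this is the situation at a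
cone point. -/
theorem continuousOn_mul_of_bounded {E : Type*} [TopologicalSpace E] {s : Set E} {a b : E → ℝ}
    {C : ℝ} (ha : ContinuousOn a s) (hb : ContinuousOn b (s ∩ {x | a x ≠ 0}))
    (hC : ∀ x ∈ s, a x ≠ 0 → |b x| ≤ C) : ContinuousOn (fun x => a x * b x) s := by
  intro x hx
  by_cases h : a x = 0
  · have h0 : Filter.Tendsto (fun y => |a y| * C) (𝓝[s] x) (𝓝 0) := by
      have := ((ha x hx).abs.mul_const C).tendsto
      simpa [h] using this
    unfold ContinuousWithinAt
    simp only [h, zero_mul]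
    refine squeeze_zero_norm' ?_ h0
    filter_upwards [self_mem_nhdsWithin] with y hy
    by_cases hy0 : a y = 0
    · simp [hy0]
    · rw [Real.norm_eq_abs, abs_mul]
      exact mul_le_mul_of_nonneg_left (hC y hy hy0) (abs_nonneg _)
  · have hmem : {y | a y ≠ 0} ∈ 𝓝[s] x := (ha x hx).eventually_ne h
    have := ((ha x hx).mono inter_subset_left).mul (hb x ⟨hx, h⟩)
    exact this.mono_of_mem_nhdsWithin (Filter.inter_mem self_mem_nhdsWithin hmem)

namespace PreAbstractSimplicialComplex

variable {U : Type*} {M : PreAbstractSimplicialComplex U}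

/-- Maps from the boundary of the `k`-simplex to `|M|` extend over the simplex. -/
def Fillable (M : PreAbstractSimplicialComplex U) (k : ℕ) : Prop :=
  ∀ f, M.IsMapOn (simplexBoundary k) f →
    ∃ F, M.IsMapOn (stdSimplex ℝ (Fin (k + 1))) F ∧ ∀ p ∈ simplexBoundary k, F p = f p

theorem fillable_of_isNConnected {n k : ℕ} (hM : IsNConnected n M.Realization) (hk : k ≤ n + 1) :
    M.Fillable k := by
  classical
  intro f hf
  obtain ⟨z⟩ := hM.1
  have : ∀ p, ∃ w : M.Realization, p ∈ simplexBoundary k → w.coord = f p := fun p => by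
    by_cases hp : p ∈ simplexBoundary k
    · exact (isPoint_coord (hf.3 p hp)).imp fun w hw _ => hw
    · exact ⟨z, fun h => absurd h hp⟩
  choose φ hφ using this
  obtain ⟨F, hF, hFφ⟩ := hM.exists_extension_simplex hk (hf.continuousOn_realization hφ)
  exact ⟨fun p => (F p).coord, isMapOn_coord (isCompact_stdSimplex ℝ _) hF, fun p hp => by
    beta_reduce
    rw [hFφ p hp, hφ p hp]⟩

-- Radial coning to the apex `a`: the barycenter goes to `a` and each ray from it to a boundary
-- point becomes a segment, which lies in `|M|` because simplices stay simplices when `a` is added.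
open Classical in
theorem fillable_of_cone {a : U} (ha : {a} ∈ M) (hM : ∀ σ ∈ M, insert a σ ∈ M) (k : ℕ) :
    M.Fillable k := by
  intro f hf
  obtain ⟨S, hS⟩ := hf.1
  -- Here `p = (1 - s p) • c p + s p • barycenter`, with `c p` the radial projection to the
  -- boundary. It is meaningless only at the barycenter, where `s p = 1` kills it.
  let s : (Fin (k + 1) → ℝ) → ℝ := fun p => (k + 1) * minCoord p
  let c : (Fin (k + 1) → ℝ) → Fin (k + 1) → ℝ := fun p j => (p j - minCoord p) / (1 - s p)
  have hs : Continuous s := continuous_const.mul continuous_minCoord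
  have hs0 : ∀ p ∈ stdSimplex ℝ (Fin (k + 1)), s p ∈ Icc (0 : ℝ) 1 := fun p hp =>
    ⟨mul_nonneg (by positivity) (minCoord_nonneg hp), mul_minCoord_le hp⟩
  have hc : ∀ p ∈ stdSimplex ℝ (Fin (k + 1)), 1 - s p ≠ 0 → c p ∈ simplexBoundary k := by
    intro p hp h
    have h1 : 0 < 1 - s p := lt_of_le_of_ne (by linarith [(hs0 p hp).2]) (Ne.symm h)
    refine ⟨⟨fun j => div_nonneg (sub_nonneg.2 (minCoord_le p j)) h1.le, ?_⟩, ?_⟩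
    · simp only [c, ← Finset.sum_div, Finset.sum_sub_distrib, hp.2]
      rw [div_eq_one_iff_eq h]
      simp [s]
    · obtain ⟨j, hj⟩ := exists_eq_minCoord p
      exact ⟨j, by simp [c, hj]⟩
  have hcc : ContinuousOn c (stdSimplex ℝ (Fin (k + 1)) ∩ {p | 1 - s p ≠ 0}) :=
    continuousOn_pi.2 fun j => (((continuous_apply j).sub continuous_minCoord).continuousOn).div
      (continuous_const.sub hs).continuousOn fun p hp => hp.2
  refine ⟨fun p v => (1 - s p) * f (c p) v + s p * if v = a then 1 else 0,
    ⟨⟨insert a S, fun p hp v hv => ?_⟩, fun v => ?_, fun p hp => ?_⟩, fun p hp => ?_⟩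
  · rw [Finset.mem_insert, not_or] at hv
    by_cases h : 1 - s p = 0
    · simp [h, hv.1]
    · simp [hv.1, hS _ (hc p hp h) v hv.2]
  · refine (continuousOn_mul_of_bounded (C := 1) (continuous_const.sub hs).continuousOn
      ((hf.2 v).comp hcc fun p hp => hc p hp.1 hp.2) fun p hp h => ?_).add
      (hs.continuousOn.mul continuousOn_const)
    have := hf.3 _ (hc p hp h)
    simp only [Function.comp_apply, abs_of_nonneg (this.1 v)]
    exact this.le_one v
  · by_cases h : 1 - s p = 0
    · have : s p = 1 := by linarith
      simpa [h, this] using IsPoint.single ha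
    · have hp' := hf.3 _ (hc p hp h)
      obtain ⟨σ, hσ, hσ'⟩ := hp'.exists_support
      exact hp'.combo (IsPoint.single ha) (hM σ hσ)
        (fun v hv => Finset.mem_insert_of_mem ((hσ' v).2 hv))
        (fun v hv => by
          have : v = a := by simpa using hv
          simp [this]) (hs0 p hp)
  · have h0 := minCoord_of_mem_simplexBoundary hp
    have : c p = p := by funext j; simp [c, s, h0]
    funext v
    simp [this, s, h0]

section Nerve

variable {ι : Type*} [Fintype ι]

/-- The face of the standard simplex spanned by `τ`. -/
def simplexFace (τ : Finset ι) : Set (ι → ℝ) := {p | p ∈ stdSimplex ℝ ι ∧ ∀ u, u ∉ τ → p u = 0}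

theorem isClosed_simplexFace (τ : Finset ι) : IsClosed (simplexFace τ) := by
  have : simplexFace τ = stdSimplex ℝ ι ∩ ⋂ u, ⋂ _ : u ∉ τ, {p | p u = 0} := by
    ext p; simp [simplexFace]
  rw [this]
  exact (isClosed_stdSimplex ℝ ι).inter (isClosed_iInter fun u => isClosed_iInter fun _ =>
    isClosed_eq (continuous_apply u) continuous_const)

theorem Fillable.exists_extension_face {k : ℕ} (hM : M.Fillable k) {τ : Finset ι}
    (hτ : τ.card = k + 1) {f : (ι → ℝ) → U → ℝ}
    (hf : M.IsMapOn {p | p ∈ simplexFace τ ∧ ∃ u ∈ τ, p u = 0} f) :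
    ∃ F, M.IsMapOn (simplexFace τ) F ∧ ∀ p ∈ simplexFace τ, (∃ u ∈ τ, p u = 0) → F p = f p := by
  classical
  let e : τ ≃ Fin (k + 1) := Finset.equivFinOfCardEq hτ
  let ext : (Fin (k + 1) → ℝ) → ι → ℝ := fun q u => if h : u ∈ τ then q (e ⟨u, h⟩) else 0
  let res : (ι → ℝ) → Fin (k + 1) → ℝ := fun p j => p (e.symm j)
  have hext : Continuous ext := by
    refine continuous_pi fun u => ?_
    by_cases h : u ∈ τ
    · simpa [ext, h] using continuous_apply _
    · simpa [ext, h] using continuous_const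
  have hres : Continuous res := continuous_pi fun j => continuous_apply _
  have hext_mem : ∀ q ∈ stdSimplex ℝ (Fin (k + 1)), ext q ∈ simplexFace τ := by
    refine fun q hq => ⟨⟨fun u => ?_, ?_⟩, fun u hu => dif_neg hu⟩
    · by_cases h : u ∈ τ
      · simpa [ext, h] using hq.1 _
      · simp [ext, h]
    · rw [← Finset.sum_subset (f := ext q) (Finset.subset_univ τ) fun u _ hu => dif_neg hu,
        ← Finset.sum_attach, ← hq.2, ← Finset.univ_eq_attach]
      exact Fintype.sum_equiv e _ _ fun u => dif_pos u.2
  have hres_mem : ∀ p ∈ simplexFace τ, res p ∈ stdSimplex ℝ (Fin (k + 1)) := by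
    refine fun p hp => ⟨fun j => hp.1.1 _, ?_⟩
    rw [← hp.1.2, ← Finset.sum_subset (Finset.subset_univ τ) fun u _ hu => hp.2 u hu,
      ← Finset.sum_attach τ, ← Finset.univ_eq_attach]
    exact Fintype.sum_equiv e.symm _ (fun u : τ => p u) fun u => rfl
  have hext_res : ∀ p ∈ simplexFace τ, ext (res p) = p := by
    intro p hp
    funext u
    by_cases h : u ∈ τ
    · simp [ext, res, h]
    · simp [ext, h, hp.2 u h]
  obtain ⟨F, hF, hFf⟩ := hM (fun q => f (ext q)) (hf.comp hext.continuousOn fun q hq => by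
    obtain ⟨j, hj⟩ := hq.2
    exact ⟨hext_mem q hq.1, e.symm j, (e.symm j).2, by simpa [ext] using hj⟩)
  refine ⟨fun p => F (res p), hF.comp hres.continuousOn hres_mem, ?_⟩
  rintro p hp ⟨u, hu, hpu⟩
  have := hFf (res p) ⟨hres_mem p hp, e ⟨u, hu⟩, by simpa [res] using hpu⟩
  simpa only [hext_res p hp] using this

open Classical in
/-- The support of a vector with finitely many coordinates. -/
noncomputable def coordSupport (p : ι → ℝ) : Finset ι := Finset.univ.filter fun u => p u ≠ 0

theorem mem_coordSupport {p : ι → ℝ} {u : ι} : u ∈ coordSupport p ↔ p u ≠ 0 := by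
  simp [coordSupport]

theorem coordSupport_nonempty {p : ι → ℝ} (hp : p ∈ stdSimplex ℝ ι) : (coordSupport p).Nonempty := by
  obtain ⟨u, -, hu⟩ := Finset.exists_ne_zero_of_sum_ne_zero (hp.2 ▸ one_ne_zero)
  exact ⟨u, mem_coordSupport.2 hu⟩

theorem coordSupport_subset {p : ι → ℝ} (hp : p ∈ stdSimplex ℝ ι) {τ : Finset ι} :
    coordSupport p ⊆ τ ↔ p ∈ simplexFace τ :=
  ⟨fun h => ⟨hp, fun _ hu => by_contra fun h0 => hu (h (mem_coordSupport.2 h0))⟩,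
    fun h _ hu => by_contra fun hu' => mem_coordSupport.1 hu (h.2 _ hu')⟩

/-- A `τ` of largest cardinality is removed from `N`. The map on the rest sends the boundary of the
face `τ` into carriers of proper faces, hence into `M τ`, where it is filled. The full simplex `⊤`
serves as a common target for all carriers. -/
theorem exists_isMapOn_of_carrier_of_finset (M : Finset ι → PreAbstractSimplicialComplex U)
    (N : Finset (Finset ι)) (hN : ∀ τ ∈ N, τ.Nonempty ∧ ∀ τ' ⊆ τ, τ'.Nonempty → τ' ∈ N)
    (hM : ∀ τ ∈ N, ∀ τ' ⊆ τ, τ'.Nonempty → M τ' ≤ M τ)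
    (hfill : ∀ τ ∈ N, ∀ k, τ.card = k + 1 → (M τ).Fillable k) :
    ∃ β : (ι → ℝ) → U → ℝ,
      (⊤ : PreAbstractSimplicialComplex U).IsMapOn {p | p ∈ stdSimplex ℝ ι ∧ coordSupport p ∈ N} β ∧
      ∀ p ∈ stdSimplex ℝ ι, coordSupport p ∈ N → (M (coordSupport p)).IsPoint (β p) := by
  classical
  induction N using Finset.strongInduction with
  | H N ih =>
  rcases N.eq_empty_or_nonempty with rfl | hne
  · refine ⟨fun _ _ => 0, ⟨⟨∅, fun _ _ _ _ => rfl⟩, fun _ => continuousOn_const, ?_⟩, ?_⟩ <;> simp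
  obtain ⟨τ, hτ, hmax⟩ := N.exists_max_image Finset.card hne
  have herase : ∀ τ' ∈ N.erase τ, τ'.Nonempty ∧ ∀ τ'' ⊆ τ', τ''.Nonempty → τ'' ∈ N.erase τ := by
    intro τ' hτ'
    obtain ⟨h1, h2⟩ := Finset.mem_erase.1 hτ'
    refine ⟨(hN τ' h2).1, fun τ'' hsub hne => Finset.mem_erase.2 ⟨?_, (hN τ' h2).2 τ'' hsub hne⟩⟩
    rintro rfl
    exact h1 (Finset.eq_of_subset_of_card_le hsub (hmax τ' h2)).symm
  obtain ⟨β', hβ', hβ'M⟩ := ih (N.erase τ) (Finset.erase_ssubset hτ) herase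
    (fun τ' h => hM τ' (Finset.mem_of_mem_erase h))
    (fun τ' h => hfill τ' (Finset.mem_of_mem_erase h))
  have hbd : ∀ p ∈ simplexFace τ, (∃ u ∈ τ, p u = 0) → coordSupport p ∈ N.erase τ := by
    rintro p hp ⟨u, hu, hpu⟩
    refine Finset.mem_erase.2 ⟨fun h => ?_, (hN τ hτ).2 _ ((coordSupport_subset hp.1).2 hp)
      (coordSupport_nonempty hp.1)⟩
    rw [← h] at hu
    exact mem_coordSupport.1 hu hpu
  obtain ⟨k, hk⟩ : ∃ k, τ.card = k + 1 :=
    Nat.exists_eq_succ_of_ne_zero (Finset.card_ne_zero.2 (hN τ hτ).1)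
  have hf : (M τ).IsMapOn {p | p ∈ simplexFace τ ∧ ∃ u ∈ τ, p u = 0} β' := by
    refine (hβ'.subset fun p hp => ⟨hp.1.1, hbd p hp.1 hp.2⟩).change fun p hp => ?_
    exact (hβ'M p hp.1.1 (hbd p hp.1 hp.2)).mono (hM τ hτ _ ((coordSupport_subset hp.1.1).2 hp.1)
      (coordSupport_nonempty hp.1.1))
  obtain ⟨F, hF, hFβ⟩ := (hfill τ hτ k hk).exists_extension_face hk hf
  let β : (ι → ℝ) → U → ℝ := fun p => if p ∈ simplexFace τ then F p else β' p
  have hβF : ∀ p ∈ simplexFace τ, β p = F p := fun p hp => if_pos hp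
  have hββ' : ∀ p ∈ stdSimplex ℝ ι, coordSupport p ∈ N.erase τ → β p = β' p := by
    intro p hp hpN
    by_cases h : p ∈ simplexFace τ
    · rw [hβF p h]
      refine hFβ p h (by_contra fun hcon => (Finset.mem_erase.1 hpN).1 ?_)
      push Not at hcon
      exact (Finset.Subset.antisymm ((coordSupport_subset hp).2 h)
        fun u hu => mem_coordSupport.2 (hcon u hu))
    · exact if_neg h
  have hclosed : IsClosed {p | p ∈ stdSimplex ℝ ι ∧ coordSupport p ∈ N.erase τ} := by
    have : {p | p ∈ stdSimplex ℝ ι ∧ coordSupport p ∈ N.erase τ} =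
        ⋃ τ' ∈ N.erase τ, simplexFace τ' := by
      ext p
      simp only [mem_ofPred_eq, mem_iUnion, exists_prop]
      refine ⟨fun h => ⟨_, h.2, (coordSupport_subset h.1).1 subset_rfl⟩, ?_⟩
      rintro ⟨τ', h1, h2⟩
      exact ⟨h2.1, (herase τ' h1).2 _ ((coordSupport_subset h2.1).2 h2)
        (coordSupport_nonempty h2.1)⟩
    rw [this]
    exact Set.Finite.isClosed_biUnion (Finset.finite_toSet _) fun τ' _ => isClosed_simplexFace τ'
  refine ⟨β, (((hβ'.congr fun p hp => hββ' p hp.1 hp.2).union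
    ((hF.congr hβF).mono le_top) hclosed (isClosed_simplexFace τ)).subset ?_), ?_⟩
  · rintro p ⟨hp, hpN⟩
    by_cases h : coordSupport p = τ
    · exact Or.inr ((coordSupport_subset hp).1 h.le)
    · exact Or.inl ⟨hp, Finset.mem_erase.2 ⟨h, hpN⟩⟩
  · intro p hp hpN
    by_cases h : coordSupport p = τ
    · have hp' : p ∈ simplexFace τ := (coordSupport_subset hp).1 h.le
      rw [hβF p hp', h]
      exact hF.3 p hp'
    · have h' := Finset.mem_erase.2 ⟨h, hpN⟩
      rw [hββ' p hp h']
      exact hβ'M p hp h'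

/-- A monotone family of carriers that satisfy the extension property up to dimension `m - 1` is
followed by a map on the `(m - 1)`-skeleton of the simplex. -/
theorem exists_isMapOn_of_carrier (M : Finset ι → PreAbstractSimplicialComplex U) (m : ℕ)
    (hM : ∀ τ τ' : Finset ι, τ' ⊆ τ → τ'.Nonempty → M τ' ≤ M τ)
    (hfill : ∀ τ : Finset ι, ∀ k, τ.card = k + 1 → k + 1 ≤ m → (M τ).Fillable k) :
    ∃ β : (ι → ℝ) → U → ℝ,
      (⊤ : PreAbstractSimplicialComplex U).IsMapOn
        {p | p ∈ stdSimplex ℝ ι ∧ (coordSupport p).card ≤ m} β ∧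
      ∀ p ∈ stdSimplex ℝ ι, (coordSupport p).card ≤ m → (M (coordSupport p)).IsPoint (β p) := by
  classical
  obtain ⟨β, hβ, hβM⟩ := exists_isMapOn_of_carrier_of_finset M
    (Finset.univ.filter fun τ => τ.Nonempty ∧ τ.card ≤ m)
    (fun τ hτ => ⟨(Finset.mem_filter.1 hτ).2.1, fun τ' h hne => Finset.mem_filter.2
      ⟨Finset.mem_univ _, hne, (Finset.card_le_card h).trans (Finset.mem_filter.1 hτ).2.2⟩⟩)
    (fun τ _ τ' h hne => hM τ τ' h hne)
    (fun τ hτ k hk => hfill τ k hk (hk ▸ (Finset.mem_filter.1 hτ).2.2))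
  have key : ∀ p ∈ stdSimplex ℝ ι, (coordSupport p).card ≤ m →
      coordSupport p ∈ Finset.univ.filter fun τ : Finset ι => τ.Nonempty ∧ τ.card ≤ m :=
    fun p hp h => Finset.mem_filter.2 ⟨Finset.mem_univ _, coordSupport_nonempty hp, h⟩
  exact ⟨β, hβ.subset fun p hp => ⟨hp.1, key p hp.1 hp.2⟩, fun p hp h => hβM p hp (key p hp h)⟩

end Nerve

end PreAbstractSimplicialComplex

end

/-! ### Fine partitions of unity on `ℝʲ` of multiplicity at most `j + 1`. -/

section

open Set Topology MeasureTheory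

/-- The length of the set of `t ∈ [0, 1)` for which rounding down `y + t` gives `u`: the hat
function at `u` of the Freudenthal triangulation. -/
noncomputable def freudenthalHat {j : ℕ} (u : Fin j → ℤ) (y : Fin j → ℝ) : ℝ :=
  max 0 ((Finset.univ.inf' Finset.univ_nonempty
      fun a : Option (Fin j) => a.elim 1 fun i => (u i : ℝ) + 1 - y i) -
    Finset.univ.sup' Finset.univ_nonempty
      fun a : Option (Fin j) => a.elim 0 fun i => (u i : ℝ) - y i)

theorem continuous_freudenthalHat {j : ℕ} (u : Fin j → ℤ) : Continuous (freudenthalHat u) := by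
  refine continuous_const.max (Continuous.sub ?_ ?_)
  · refine Continuous.finset_inf'_apply _ fun a _ => ?_
    cases a <;> simp <;> fun_prop
  · refine Continuous.finset_sup'_apply _ fun a _ => ?_
    cases a <;> simp <;> fun_prop

theorem setOf_floor_eq {j : ℕ} (u : Fin j → ℤ) (y : Fin j → ℝ) :
    {t : ℝ | t ∈ Ico (0 : ℝ) 1 ∧ ∀ i, ⌊y i + t⌋ = u i} =
      Ico (Finset.univ.sup' Finset.univ_nonempty
          fun a : Option (Fin j) => a.elim 0 fun i => (u i : ℝ) - y i)
        (Finset.univ.inf' Finset.univ_nonempty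
          fun a : Option (Fin j) => a.elim 1 fun i => (u i : ℝ) + 1 - y i) := by
  ext t
  simp only [mem_ofPred_eq, mem_Ico, Finset.sup'_le_iff, Finset.lt_inf'_iff, Finset.mem_univ,
    forall_const, Option.forall, Option.elim, Int.floor_eq_iff]
  constructor
  · rintro ⟨⟨h0, h1⟩, h⟩
    exact ⟨⟨h0, fun i => by linarith [(h i).1]⟩, h1, fun i => by linarith [(h i).2]⟩
  · rintro ⟨⟨h0, h⟩, h1, h'⟩
    exact ⟨⟨h0, h1⟩, fun i => ⟨by linarith [h i], by linarith [h' i]⟩⟩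

theorem volume_floor_eq {j : ℕ} (u : Fin j → ℤ) (y : Fin j → ℝ) :
    volume.real {t : ℝ | t ∈ Ico (0 : ℝ) 1 ∧ ∀ i, ⌊y i + t⌋ = u i} = freudenthalHat u y := by
  rw [setOf_floor_eq, Measure.real, Real.volume_Ico, ENNReal.toReal_ofReal', freudenthalHat,
    max_comm]

theorem freudenthalHat_nonneg {j : ℕ} (u : Fin j → ℤ) (y : Fin j → ℝ) : 0 ≤ freudenthalHat u y :=
  le_max_left _ _

theorem exists_floor_eq {j : ℕ} {u : Fin j → ℤ} {y : Fin j → ℝ} (h : freudenthalHat u y ≠ 0) :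
    ∃ t ∈ Ico (0 : ℝ) 1, ∀ i, ⌊y i + t⌋ = u i := by
  by_contra! hcon
  apply h
  rw [← volume_floor_eq, show {t : ℝ | t ∈ Ico (0 : ℝ) 1 ∧ ∀ i, ⌊y i + t⌋ = u i} = ∅ from ?_]
  · simp
  · refine eq_empty_of_forall_notMem fun t ht => ?_
    obtain ⟨i, hi⟩ := hcon t ht.1
    exact hi (ht.2 i)

/-- The sets of `t` that round to distinct `u` partition `[0, 1)`, so their lengths add up to `1`.
-/
theorem sum_freudenthalHat {j : ℕ} {R : Finset (Fin j → ℤ)} {y : Fin j → ℝ}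
    (hR : ∀ t ∈ Ico (0 : ℝ) 1, (fun i => ⌊y i + t⌋) ∈ R) : ∑ u ∈ R, freudenthalHat u y = 1 := by
  simp only [← volume_floor_eq]
  rw [← measureReal_biUnion_finset ?_ ?_ fun u _ => ?_]
  · rw [show (⋃ u ∈ R, {t : ℝ | t ∈ Ico (0 : ℝ) 1 ∧ ∀ i, ⌊y i + t⌋ = u i}) = Ico (0 : ℝ) 1 from ?_]
    · simp [Measure.real]
    · ext t
      simp only [mem_iUnion, mem_ofPred_eq, exists_prop]
      exact ⟨fun ⟨u, _, h, _⟩ => h, fun h => ⟨_, hR t h, h, fun i => rfl⟩⟩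
  · intro u _ u' _ huu'
    refine Set.disjoint_left.2 fun t h h' => huu' ?_
    funext i
    rw [← h.2 i, h'.2 i]
  · intro u _
    rw [setOf_floor_eq]
    exact measurableSet_Ico
  · rw [setOf_floor_eq]
    simp

/-- As `t` grows, `⌊y + t⌋` increases from `⌊y⌋` to at most `⌊y⌋ + 1` in each coordinate. Its values
form a chain, so they are told apart by their coordinate sums, which take at most `j + 1` values. -/
theorem card_le_of_freudenthalHat_ne_zero {j : ℕ} {R : Finset (Fin j → ℤ)} {y : Fin j → ℝ}
    (hR : ∀ u ∈ R, freudenthalHat u y ≠ 0) : R.card ≤ j + 1 := by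
  have h1 : ∀ u ∈ R, ∑ i, u i ∈ Finset.Icc (∑ i, ⌊y i⌋) (∑ i, ⌊y i⌋ + j) := by
    intro u hu
    obtain ⟨t, ht, h⟩ := exists_floor_eq (hR u hu)
    rw [Finset.mem_Icc]
    constructor
    · exact Finset.sum_le_sum fun i _ => h i ▸ Int.floor_mono (by linarith [ht.1])
    · have : ∀ i ∈ Finset.univ, u i ≤ ⌊y i⌋ + 1 := fun i _ => by
        rw [← h i, ← Int.floor_add_one]
        exact Int.floor_mono (by linarith [ht.2])
      refine (Finset.sum_le_sum this).trans ?_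
      simp [Finset.sum_add_distrib]
  have h2 : ∀ u ∈ R, ∀ u' ∈ R, ∑ i, u i = ∑ i, u' i → u = u' := by
    have key : ∀ u u' : Fin j → ℤ, u ≤ u' → ∑ i, u i = ∑ i, u' i → u = u' := fun u u' hle hs =>
      funext fun i => (Finset.sum_eq_sum_iff_of_le fun i _ => hle i).1 hs i (Finset.mem_univ i)
    intro u hu u' hu' hs
    obtain ⟨t, ht, h⟩ := exists_floor_eq (hR u hu)
    obtain ⟨t', ht', h'⟩ := exists_floor_eq (hR u' hu')
    rcases le_total t t' with hle | hle
    · exact key u u' (fun i => h i ▸ h' i ▸ Int.floor_mono (by linarith)) hs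
    · exact (key u' u (fun i => h i ▸ h' i ▸ Int.floor_mono (by linarith)) hs.symm).symm
  have := Finset.card_le_card_of_injOn (fun u : Fin j → ℤ => ∑ i, u i)
    (t := Finset.Icc (∑ i, ⌊y i⌋) (∑ i, ⌊y i⌋ + j)) (fun u hu => h1 u hu)
    fun u hu u' hu' => h2 u hu u' hu'
  simp only [Int.card_Icc] at this
  omega

/-- Arbitrarily fine partitions of unity with multiplicity at most `j + 1` on bounded subsets
of `ℝʲ`. -/
theorem exists_small_partition {j : ℕ} {T : Set (Fin j → ℝ)} (hT : Bornology.IsBounded T) {ε : ℝ}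
    (hε : 0 < ε) : ∃ (ι : Type) (_ : Fintype ι) (c : ι → Fin j → ℝ) (lam : (Fin j → ℝ) → ι → ℝ),
      (∀ u, c u ∈ T) ∧ Continuous lam ∧ (∀ x ∈ T, lam x ∈ stdSimplex ℝ ι) ∧
      (∀ x ∈ T, ∀ u, lam x u ≠ 0 → dist x (c u) < ε) ∧
      ∀ x (R : Finset ι), (∀ u ∈ R, lam x u ≠ 0) → R.card ≤ j + 1 := by
  classical
  -- If the hat at `u` is nonzero at `N x` and at `N c(u)`, both are within `1` of `u` in each
  -- coordinate, so `x` and `c(u)` are closer than `2 / N < ε`.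
  obtain ⟨N, hN⟩ := exists_nat_gt (2 / ε)
  have hN0 : (0 : ℝ) < N := lt_trans (by positivity) hN
  obtain ⟨C, hC⟩ := hT.exists_norm_le
  let B : ℤ := ⌈N * C⌉ + 1
  -- Hats that vanish on all of `T` are dropped: the sum on `T` is unchanged, and every remaining
  -- index has a sample point in `T`.
  let R : Finset (Fin j → ℤ) := (Fintype.piFinset fun _ => Finset.Icc (-B) B).filter fun u =>
    ∃ x ∈ T, freudenthalHat u (fun i => N * x i) ≠ 0
  have hmem : ∀ u : R, ∃ x ∈ T, freudenthalHat u.1 (fun i => N * x i) ≠ 0 := fun u =>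
    (Finset.mem_filter.1 u.2).2
  choose c hc hc0 using hmem
  refine ⟨R, inferInstance, c, fun x u => freudenthalHat u.1 fun i => N * x i, hc, ?_, ?_, ?_, ?_⟩
  · exact continuous_pi fun u => (continuous_freudenthalHat u.1).comp (by fun_prop)
  · refine fun x hx => ⟨fun u => freudenthalHat_nonneg _ _, ?_⟩
    rw [Finset.univ_eq_attach, Finset.sum_attach R fun u => freudenthalHat u fun i => N * x i,
      Finset.sum_filter_of_ne fun u _ h => ⟨x, hx, h⟩]
    refine sum_freudenthalHat fun t ht => Fintype.mem_piFinset.2 fun i => Finset.mem_Icc.2 ?_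
    have h1 : |x i| ≤ C := (norm_le_pi_norm x i).trans (hC x hx)
    have h2 := abs_le.1 h1
    have h3 : N * C ≤ ⌈N * C⌉ := Int.le_ceil _
    constructor
    · rw [Int.le_floor]
      push_cast [B]
      nlinarith [ht.1]
    · rw [Int.floor_le_iff]
      push_cast [B]
      nlinarith [ht.2]
  · intro x hx u hu
    obtain ⟨t, ht, h⟩ := exists_floor_eq hu
    obtain ⟨t', ht', h'⟩ := exists_floor_eq (hc0 u)
    refine (dist_pi_lt_iff hε).2 fun i => ?_
    have h1 := Int.floor_eq_iff.1 (h i)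
    have h2 := Int.floor_eq_iff.1 (h' i)
    rw [div_lt_iff₀ hε] at hN
    rw [Real.dist_eq, abs_lt]
    constructor <;> nlinarith [ht.1, ht.2, ht'.1, ht'.2]
  · intro x S hS
    rw [← Finset.card_map (Function.Embedding.subtype _)]
    refine card_le_of_freudenthalHat_ne_zero (y := fun i => N * x i) fun u hu => ?_
    obtain ⟨u', hu', rfl⟩ := Finset.mem_map.1 hu
    exact hS u' hu'

end

/-! ### Approximation with small supports, and the choice of points over `X ∩ Y`. -/

section

open Set Topology

namespace PreAbstractSimplicialComplex

variable {U : Type*} {K : PreAbstractSimplicialComplex U}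

theorem IsMapOn.exists_dist_lt {E : Type*} [PseudoMetricSpace E] {T : Set E} (hT : IsCompact T)
    {f : E → U → ℝ} (hf : K.IsMapOn T f) {δ : ℝ} (hδ : 0 < δ) :
    ∃ ε > 0, ∀ x ∈ T, ∀ y ∈ T, dist x y < ε → ∀ v, |f x v - f y v| < δ := by
  obtain ⟨S, hS⟩ := hf.1
  have hc : ContinuousOn (fun x (v : S) => f x v) T := continuousOn_pi.2 fun v => hf.2 v
  obtain ⟨ε, hε, h⟩ := Metric.uniformContinuousOn_iff.1
    (hT.uniformContinuousOn_of_continuous hc) δ hδ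
  refine ⟨ε, hε, fun x hx y hy hxy v => ?_⟩
  by_cases hv : v ∈ S
  · exact (dist_pi_lt_iff hδ).1 (h x hx y hy hxy) ⟨v, hv⟩
  · rwa [hS x hx v hv, hS y hy v hv, sub_zero, abs_zero]

/-- Approximation by a map to the `j`-skeleton whose supports are smaller. -/
theorem IsMapOn.exists_skeletal {j : ℕ} {T : Set (Fin j → ℝ)} (hT : IsCompact T)
    {φ : (Fin j → ℝ) → U → ℝ} (hφ : K.IsMapOn T φ) :
    ∃ ψ : (Fin j → ℝ) → U → ℝ, K.IsMapOn T ψ ∧ ∀ x ∈ T, (∀ v, ψ x v ≠ 0 → φ x v ≠ 0) ∧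
      ∀ R : Finset U, (∀ v ∈ R, ψ x v ≠ 0) → R.card ≤ j + 1 := by
  classical
  obtain ⟨S, hS⟩ := hφ.1
  rcases T.eq_empty_or_nonempty with rfl | ⟨x₀, hx₀⟩
  · exact ⟨φ, hφ, by simp⟩
  have hS0 : (0 : ℝ) < S.card := by
    have h1 := (hφ.3 x₀ hx₀).sum_eq_one (hS x₀ hx₀)
    rw [Nat.cast_pos, Finset.card_pos]
    by_contra h
    simp [Finset.not_nonempty_iff_eq_empty.1 h] at h1
  -- Each sample point has a coordinate of at least `1 / |S|`, since the coordinates over `S` sum to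
  -- `1`. That coordinate stays nonzero at distance less than `ε`.
  obtain ⟨ε, hε, hdist⟩ := hφ.exists_dist_lt hT (inv_pos.2 hS0)
  obtain ⟨ι, _, c, lam, hc, hlam, hstd, hsmall, hmult⟩ := exists_small_partition hT.isBounded hε
  have hvtx : ∀ u, ∃ v ∈ S, (S.card : ℝ)⁻¹ ≤ φ (c u) v := by
    intro u
    by_contra! h
    have h1 := (hφ.3 _ (hc u)).sum_eq_one (hS _ (hc u))
    have h2 := Finset.sum_lt_sum_of_nonempty (Finset.card_pos.1 (Nat.cast_pos.1 hS0)) h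
    rw [h1] at h2
    simp [hS0.ne'] at h2
  choose vtx hvtxS hvtx using hvtx
  let ψ : (Fin j → ℝ) → U → ℝ := fun x v => ∑ u with vtx u = v, lam x u
  have hψ0 : ∀ x v, ψ x v ≠ 0 → ∃ u, vtx u = v ∧ lam x u ≠ 0 := fun x v h => by
    obtain ⟨u, hu, h'⟩ := Finset.exists_ne_zero_of_sum_ne_zero h
    exact ⟨u, (Finset.mem_filter.1 hu).2, h'⟩
  have hψφ : ∀ x ∈ T, ∀ v, ψ x v ≠ 0 → φ x v ≠ 0 := by
    intro x hx v hv h0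
    obtain ⟨u, rfl, hu⟩ := hψ0 x v hv
    have h1 := hdist x hx _ (hc u) (hsmall x hx u hu) (vtx u)
    rw [h0, zero_sub, abs_neg] at h1
    exact absurd (hvtx u) (not_le.2 ((le_abs_self _).trans_lt h1))
  have hψS : ∀ x v, v ∉ S → ψ x v = 0 := fun x v hv => by
    by_contra h
    obtain ⟨u, rfl, -⟩ := hψ0 x v h
    exact hv (hvtxS u)
  refine ⟨ψ, ⟨⟨S, fun x _ => hψS x⟩, fun v => ?_, fun x hx => ?_⟩,
    fun x hx => ⟨hψφ x hx, fun R hR => ?_⟩⟩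
  · exact (continuous_finsetSum _ fun u _ => (continuous_apply u).comp hlam).continuousOn
  · obtain ⟨σ, hσ, hσ'⟩ := (hφ.3 x hx).exists_support
    refine IsPoint.of_sum_eq_one (S := S) (fun v => Finset.sum_nonneg fun u _ => (hstd x hx).1 u)
      (hψS x) ?_ hσ fun v hv => (hσ' v).2 (hψφ x hx v hv)
    rw [← (hstd x hx).2]
    exact Finset.sum_fiberwise_of_maps_to (fun u _ => hvtxS u) _
  · have hsub : R ⊆ (coordSupport (lam x)).image vtx := fun v hv => by
      obtain ⟨u, rfl, hu⟩ := hψ0 x v (hR v hv)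
      exact Finset.mem_image_of_mem _ (mem_coordSupport.2 hu)
    exact (Finset.card_le_card hsub).trans (Finset.card_image_le.trans
      (hmult x _ fun u hu => mem_coordSupport.1 hu))

/-- Points with few nonzero coordinates are pushed off their small coordinates. -/
theorem IsMapOn.exists_threshold {E : Type*} [TopologicalSpace E] {T : Set E}
    {ψ : E → U → ℝ} (hψ : K.IsMapOn T ψ) {δ : ℝ} (hδ : 0 < δ) {m : ℕ} (hm : m * δ < 1)
    (hcard : ∀ x ∈ T, ∀ R : Finset U, (∀ v ∈ R, ψ x v ≠ 0) → R.card ≤ m) :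
    ∃ χ : E → U → ℝ, K.IsMapOn T χ ∧ ∀ x ∈ T, ∀ v, χ x v ≠ 0 → δ ≤ ψ x v := by
  classical
  obtain ⟨S, hS⟩ := hψ.1
  let D : E → ℝ := fun x => ∑ v ∈ S, max 0 (ψ x v - δ)
  -- At most `m` coordinates are nonzero, so subtracting `δ` from each removes at most `m * δ < 1`
  -- of the mass.
  have hD : ∀ x ∈ T, 0 < D x := by
    intro x hx
    have h1 := (hψ.3 x hx).sum_eq_one (hS x hx)
    rw [← Finset.sum_filter_ne_zero] at h1
    have h2 := hcard x hx (S.filter fun v => ψ x v ≠ 0) fun v hv => (Finset.mem_filter.1 hv).2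
    calc (0 : ℝ) < 1 - (S.filter fun v => ψ x v ≠ 0).card * δ := by
          have : ((S.filter fun v => ψ x v ≠ 0).card : ℝ) ≤ m := by exact_mod_cast h2
          nlinarith
      _ = ∑ v ∈ S with ψ x v ≠ 0, (ψ x v - δ) := by
          rw [Finset.sum_sub_distrib, h1]; simp
      _ ≤ ∑ v ∈ S with ψ x v ≠ 0, max 0 (ψ x v - δ) :=
          Finset.sum_le_sum fun v _ => le_max_right _ _
      _ ≤ D x := Finset.sum_le_sum_of_subset_of_nonneg (Finset.filter_subset _ _)
          fun v _ _ => le_max_left _ _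
  have hχ : ∀ x v, max 0 (ψ x v - δ) / D x ≠ 0 → δ ≤ ψ x v := by
    intro x v h
    by_contra! h'
    exact h (by rw [max_eq_left (by linarith), zero_div])
  refine ⟨fun x v => max 0 (ψ x v - δ) / D x, ⟨⟨S, fun x hx v hv => ?_⟩, fun v => ?_,
    fun x hx => ?_⟩, fun x _ => hχ x⟩
  · rw [hS x hx v hv, max_eq_left (by linarith), zero_div]
  · refine ContinuousOn.div (continuousOn_const.sup ((hψ.2 v).sub continuousOn_const))
      (continuousOn_finsetSum _ fun v _ => continuousOn_const.sup
        ((hψ.2 v).sub continuousOn_const)) fun x hx => (hD x hx).ne'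
  · obtain ⟨σ, hσ, hσ'⟩ := (hψ.3 x hx).exists_support
    refine IsPoint.of_sum_eq_one (S := S)
      (fun v => div_nonneg (le_max_left _ _) (hD x hx).le) (fun v hv => ?_) ?_ hσ
      fun v hv => (hσ' v).2 (hδ.trans_le (hχ x v hv)).ne'
    · rw [hS x hx v hv, max_eq_left (by linarith), zero_div]
    · rw [← Finset.sum_div]
      exact div_self (hD x hx).ne'

/-- This contravariance makes the carriers in `exists_joinable` monotone. -/
theorem obstruction_anti {σ τ : Finset U} (h : σ ⊆ τ) (hσ : σ.Nonempty) (A : Set U) :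
    K.obstruction τ A ≤ K.obstruction σ A := by
  classical
  rintro μ ⟨h1, h2, h3⟩
  exact ⟨h1, h2, mem_of_subset h3 (Finset.union_subset_union_right h)
    (hσ.mono Finset.subset_union_right)⟩

/-- Extension property of the obstruction complexes of simplices that meet both `X \ Y` and
`Y \ X`. -/
theorem fillable_obstruction {X Y : Set U} {n : ℕ}
    (hSt : ∀ σ ∈ K.skeleton (n + 1), σ ∉ K.decompositionPoset X Y →
      IsNConnected n (K.obstruction σ (X ∩ Y)).Realization) {σ : Finset U} (hσ : σ ∈ K)
    (hcard : σ.card ≤ n + 2) (hX : ∃ v ∈ σ, v ∉ Y) (hY : ∃ v ∈ σ, v ∉ X) {k : ℕ}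
    (hk : k ≤ n + 1) : (K.obstruction σ (X ∩ Y)).Fillable k := by
  classical
  -- If `σ` meets `X ∩ Y`, it belongs to the poset and the hypothesis says nothing, but the
  -- obstruction complex is then a cone with apex any such vertex.
  by_cases hA : ∃ a ∈ σ, a ∈ X ∩ Y
  · obtain ⟨a, haσ, haA⟩ := hA
    refine fillable_of_cone (M := K.obstruction σ (X ∩ Y)) (a := a) ?_ ?_ k
    · refine ⟨by simpa using haA, Finset.singleton_nonempty a, ?_⟩
      rwa [Finset.singleton_union, Finset.insert_eq_of_mem haσ]
    · rintro μ ⟨h1, h2, h3⟩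
      refine ⟨?_, Finset.insert_nonempty a μ, ?_⟩
      · rw [Finset.coe_insert]
        exact insert_subset haA h1
      · rwa [Finset.insert_union, Finset.insert_eq_of_mem (Finset.mem_union_right _ haσ)]
  · refine fillable_of_isNConnected (hSt σ ⟨hσ, hcard⟩ ?_) hk
    rintro ⟨-, h | h | ⟨a, ha, haA⟩⟩
    · obtain ⟨v, hv, hvX⟩ := hY
      exact hvX (h hv)
    · obtain ⟨v, hv, hvY⟩ := hX
      exact hvY (h hv)
    · exact hA ⟨a, ha, haA⟩

/-- A map to the full simplex whose values at points with large coordinates in both `X \ Y` and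
`Y \ X` can be joined to these points by segments, and are supported in `X ∩ Y`. -/
theorem IsMapOn.exists_joinable {X Y : Set U} {n : ℕ}
    (hSt : ∀ σ ∈ K.skeleton (n + 1), σ ∉ K.decompositionPoset X Y →
      IsNConnected n (K.obstruction σ (X ∩ Y)).Realization)
    {j : ℕ} (hj : j ≤ n + 1) {T : Set (Fin j → ℝ)} (hT : IsCompact T)
    {ψ : (Fin j → ℝ) → U → ℝ} (hψ : K.IsMapOn T ψ) {δ : ℝ} (hδ : 0 < δ)
    (hcard : ∀ x ∈ T, ∀ R : Finset U, (∀ v ∈ R, ψ x v ≠ 0) → R.card ≤ n + 2) :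
    ∃ α : (Fin j → ℝ) → U → ℝ, (⊤ : PreAbstractSimplicialComplex U).IsMapOn T α ∧
      ∀ x ∈ T, ∀ R : Finset U, (∀ v ∈ R, δ ≤ ψ x v) → (∃ v ∈ R, v ∉ Y) → (∃ v ∈ R, v ∉ X) →
        ∃ σ ∈ K, R ⊆ σ ∧ ∀ v, α x v ≠ 0 → v ∈ X ∩ Y ∧ v ∈ σ := by
  classical
  obtain ⟨S, hS⟩ := hψ.1
  obtain ⟨ε, hε, hdist⟩ := hψ.exists_dist_lt hT hδ
  obtain ⟨ι, _, c, lam, hc, hlam, hstd, hsmall, hmult⟩ := exists_small_partition hT.isBounded hε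
  -- The common support at the sample points of `τ`: it shrinks as `τ` grows, and for nonempty `τ`
  -- has at most `n + 2` elements and is a simplex unless empty.
  let S' : Finset ι → Finset U := fun τ => S.filter fun v => ∀ u ∈ τ, ψ (c u) v ≠ 0
  let bad : Finset U → Prop := fun σ => (∃ v ∈ σ, v ∉ Y) ∧ ∃ v ∈ σ, v ∉ X
  have hbad : ∀ {σ τ : Finset U}, σ ⊆ τ → bad σ → bad τ := fun h hσ =>
    ⟨hσ.1.imp fun v hv => ⟨h hv.1, hv.2⟩, hσ.2.imp fun v hv => ⟨h hv.1, hv.2⟩⟩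
  have hbad0 : ∀ {σ : Finset U}, bad σ → σ.Nonempty := fun hσ => hσ.1.imp fun v hv => hv.1
  -- When the common support does not meet both sides there is no constraint, and the full simplex
  -- is a cone.
  let M : Finset ι → PreAbstractSimplicialComplex U := fun τ =>
    if bad (S' τ) then K.obstruction (S' τ) (X ∩ Y) else ⊤
  obtain ⟨β, hβ, hβM⟩ := exists_isMapOn_of_carrier M (n + 2) (fun τ τ' hττ' _ => by
      have hsub : S' τ ⊆ S' τ' := fun v hv => by
        simp only [S', Finset.mem_filter] at hv ⊢
        exact ⟨hv.1, fun u hu => hv.2 u (hττ' hu)⟩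
      by_cases h : bad (S' τ)
      · simp only [M, h, hbad hsub h, if_true]
        exact obstruction_anti hsub (hbad0 h) _
      · simp only [M, h, if_false]
        exact le_top)
    (fun τ k hk hkn => by
      obtain ⟨u, hu⟩ := Finset.card_pos.1 (show 0 < τ.card by omega)
      by_cases h : bad (S' τ)
      · simp only [M, h, if_true]
        have h0 : ∀ v ∈ S' τ, ψ (c u) v ≠ 0 := fun v hv => (Finset.mem_filter.1 hv).2 u hu
        exact fillable_obstruction hSt ((hψ.3 _ (hc u)).mem_of_ne_zero (hbad0 h) h0)
          (hcard _ (hc u) _ h0) h.1 h.2 (by omega)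
      · simp only [M, h, if_false]
        obtain ⟨a, -⟩ := (hψ.3 _ (hc u)).exists_ne_zero
        exact fillable_of_cone (a := a) (Finset.singleton_nonempty a)
          (fun μ _ => Finset.insert_nonempty a μ) k)
  have hmem : ∀ x ∈ T, lam x ∈ stdSimplex ℝ ι ∧ (coordSupport (lam x)).card ≤ n + 2 :=
    fun x hx => ⟨hstd x hx, (hmult x _ fun u hu => mem_coordSupport.1 hu).trans (by omega)⟩
  refine ⟨fun x => β (lam x), hβ.comp hlam.continuousOn hmem, fun x hx R hR hRY hRX => ?_⟩
  -- Coordinates vary by less than `δ` between `x` and the sample points near it, so those of size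
  -- at least `δ` at `x` are nonzero at all of these.
  have hsub : R ⊆ S' (coordSupport (lam x)) := by
    intro v hv
    refine Finset.mem_filter.2 ⟨by_contra fun h => ?_, fun u hu h => ?_⟩
    · have := hR v hv
      rw [hS x hx v h] at this
      linarith
    · have h1 := hdist x hx _ (hc u) (hsmall x hx u (mem_coordSupport.1 hu)) v
      rw [h, sub_zero] at h1
      exact absurd (hR v hv) (not_le.2 ((le_abs_self _).trans_lt h1))
  have hb := hβM _ (hmem x hx).1 (hmem x hx).2
  simp only [M, if_pos (hbad hsub ⟨hRY, hRX⟩)] at hb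
  obtain ⟨μ, ⟨h1, h2, h3⟩, hμ⟩ := hb.exists_support
  exact ⟨_, h3, hsub.trans Finset.subset_union_right, fun v hv =>
    ⟨h1 ((hμ v).2 hv), Finset.mem_union_left _ ((hμ v).2 hv)⟩⟩

end PreAbstractSimplicialComplex

end

/-! ### Pushing into `|K_X ∪ K_Y|`: deformation and prism extension. -/

section

open Set Topology

namespace PreAbstractSimplicialComplex

variable {U : Type*} {K : PreAbstractSimplicialComplex U}

theorem IsPoint.restriction {Z : Set U} {w : U → ℝ} (h : K.IsPoint w)
    (hw : ∀ v, w v ≠ 0 → v ∈ Z) : (K.restriction Z).IsPoint w := by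
  obtain ⟨σ, hσ, hσ'⟩ := h.exists_support
  obtain ⟨S, -, hS⟩ := h.2
  exact IsPoint.of_sum_eq_one h.1 hS.1 hS.2 (σ := σ) ⟨hσ, fun v hv => hw v ((hσ' v).1 hv)⟩
    fun v hv => (hσ' v).2 hv

theorem IsPoint.mem_or_mem_of_sup {X Y : Set U} {w : U → ℝ}
    (h : (K.restriction X ⊔ K.restriction Y).IsPoint w) :
    (∀ v, w v ≠ 0 → v ∈ X) ∨ ∀ v, w v ≠ 0 → v ∈ Y := by
  obtain ⟨σ, hσ, hσ'⟩ := h.exists_support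
  rcases hσ with hσ | hσ
  · exact Or.inl fun v hv => hσ.2 ((hσ' v).2 hv)
  · exact Or.inr fun v hv => hσ.2 ((hσ' v).2 hv)

theorem IsPoint.mem_vertexSet {w : U → ℝ} (h : K.IsPoint w) {v : U} (hv : w v ≠ 0) :
    v ∈ K.vertexSet :=
  h.mem_of_ne_zero (Finset.singleton_nonempty v) fun v' hv' => by
    rw [Finset.mem_singleton.1 hv']; exact hv

/-- Points of `|K|` that can be joined to points supported in `X ∩ Y` whenever their support meets
both `X \ Y` and `Y \ X` are pushed to `|K_X ∪ K_Y|` along straight lines. -/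
theorem IsMapOn.exists_push {X Y : Set U} (hXY : X ∪ Y = K.vertexSet) {E : Type*}
    [TopologicalSpace E] {T : Set E} {χ α : E → U → ℝ} (hχ : K.IsMapOn T χ)
    (hα : (⊤ : PreAbstractSimplicialComplex U).IsMapOn T α)
    (hχα : ∀ x ∈ T, ∀ R : Finset U, (∀ v ∈ R, χ x v ≠ 0) → (∃ v ∈ R, v ∉ Y) → (∃ v ∈ R, v ∉ X) →
        ∃ σ ∈ K, R ⊆ σ ∧ ∀ v, α x v ≠ 0 → v ∈ X ∩ Y ∧ v ∈ σ) :
    ∃ g : E → U → ℝ, (K.restriction X ⊔ K.restriction Y).IsMapOn T g ∧ ∀ x ∈ T,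
      (∃ σ ∈ K, (∀ v, χ x v ≠ 0 → v ∈ σ) ∧ ∀ v, g x v ≠ 0 → v ∈ σ) ∧
      ((K.restriction X ⊔ K.restriction Y).IsPoint (χ x) → g x = χ x) := by
  classical
  obtain ⟨S, hS⟩ := hχ.1
  obtain ⟨S', hS'⟩ := hα.1
  let mX : E → ℝ := fun x => ∑ v ∈ S with v ∉ Y, χ x v
  let mY : E → ℝ := fun x => ∑ v ∈ S with v ∉ X, χ x v
  -- Each coordinate on one side loses the total mass of the other side, cut off at zero. The total
  -- `lost` is redistributed along `α` in `g`.
  let base : E → U → ℝ := fun x v =>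
    if v ∉ Y then max 0 (χ x v - mY x) else if v ∉ X then max 0 (χ x v - mX x) else χ x v
  let lost : E → ℝ := fun x => 1 - ∑ v ∈ S, base x v
  have hmem : ∀ x ∈ T, ∀ v, χ x v ≠ 0 → v ∈ X ∪ Y := fun x hx v hv => by
    rw [hXY]; exact (hχ.3 x hx).mem_vertexSet hv
  have hmX0 : ∀ x ∈ T, 0 ≤ mX x := fun x hx => Finset.sum_nonneg fun v _ => (hχ.3 x hx).1 v
  have hmY0 : ∀ x ∈ T, 0 ≤ mY x := fun x hx => Finset.sum_nonneg fun v _ => (hχ.3 x hx).1 v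
  have hmX : ∀ x ∈ T, ∀ v, v ∉ Y → χ x v ≤ mX x := by
    intro x hx v hv
    by_cases hvS : v ∈ S
    · exact Finset.single_le_sum (f := χ x) (fun v _ => (hχ.3 x hx).1 v)
        (Finset.mem_filter.2 ⟨hvS, hv⟩)
    · rw [hS x hx v hvS]; exact hmX0 x hx
  have hmY : ∀ x ∈ T, ∀ v, v ∉ X → χ x v ≤ mY x := by
    intro x hx v hv
    by_cases hvS : v ∈ S
    · exact Finset.single_le_sum (f := χ x) (fun v _ => (hχ.3 x hx).1 v)
        (Finset.mem_filter.2 ⟨hvS, hv⟩)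
    · rw [hS x hx v hvS]; exact hmY0 x hx
  have hbase0 : ∀ x ∈ T, ∀ v, 0 ≤ base x v := by
    intro x hx v
    simp only [base]
    split_ifs
    exacts [(hχ.3 x hx).1 v, le_max_left _ _, le_max_left _ _]
  have hbase_le : ∀ x ∈ T, ∀ v, base x v ≤ χ x v := by
    intro x hx v
    simp only [base]
    split_ifs
    exacts [le_rfl, max_le ((hχ.3 x hx).1 v) (by linarith [hmX0 x hx]),
      max_le ((hχ.3 x hx).1 v) (by linarith [hmY0 x hx])]
  have hbase_ne : ∀ x ∈ T, ∀ v, base x v ≠ 0 → χ x v ≠ 0 := fun x hx v h h0 =>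
    h (le_antisymm (h0 ▸ hbase_le x hx v) (hbase0 x hx v))
  have hlost : ∀ x ∈ T, 0 ≤ lost x := fun x hx => by
    have := Finset.sum_le_sum fun v (_ : v ∈ S) => hbase_le x hx v
    rw [(hχ.3 x hx).sum_eq_one (hS x hx)] at this
    exact sub_nonneg.2 this
  -- If one side carries no mass, nothing is removed; this is why points of `|K_X ∪ K_Y|` do not
  -- move.
  have hdeg : ∀ x ∈ T, mX x = 0 ∨ mY x = 0 → base x = χ x := by
    intro x hx h
    funext v
    have h0 := (hχ.3 x hx).1 v
    by_cases hvY : v ∉ Y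
    · simp only [base, hvY, not_false_eq_true, if_true]
      rcases h with h | h
      · have : χ x v = 0 := le_antisymm (h ▸ hmX x hx v hvY) h0
        rw [this, max_eq_left (by linarith [hmY0 x hx])]
      · rw [h, sub_zero, max_eq_right h0]
    · by_cases hvX : v ∉ X
      · simp only [base, hvY, hvX, not_false_eq_true, if_true, if_false]
        rcases h with h | h
        · rw [h, sub_zero, max_eq_right h0]
        · have : χ x v = 0 := le_antisymm (h ▸ hmY x hx v hvX) h0
          rw [this, max_eq_left (by linarith [hmX0 x hx])]
      · simp only [base, hvY, hvX, if_false]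
  let g : E → U → ℝ := fun x v => base x v + lost x * α x v
  have hgdeg : ∀ x ∈ T, mX x = 0 ∨ mY x = 0 → g x = χ x := by
    intro x hx h
    have h1 : lost x = 0 := by
      simp only [lost, hdeg x hx h, (hχ.3 x hx).sum_eq_one (hS x hx), sub_self]
    funext v
    simp only [g, h1, zero_mul, add_zero, hdeg x hx h]
  have hgS : ∀ x ∈ T, ∀ v, v ∉ S ∪ S' → g x v = 0 := by
    intro x hx v hv
    rw [Finset.mem_union, not_or] at hv
    have h1 : base x v = 0 := by_contra fun h => hbase_ne x hx v h (hS x hx v hv.1)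
    simp only [g, h1, hS' x hx v hv.2, mul_zero, add_zero]
  have hg0 : ∀ x ∈ T, ∀ v, 0 ≤ g x v := fun x hx v =>
    add_nonneg (hbase0 x hx v) (mul_nonneg (hlost x hx) ((hα.3 x hx).1 v))
  have hgsum : ∀ x ∈ T, ∑ v ∈ S ∪ S', g x v = 1 := by
    intro x hx
    simp only [g]
    rw [Finset.sum_add_distrib, ← Finset.mul_sum, (hα.3 x hx).sum_eq_one fun v hv =>
        hS' x hx v fun h => hv (Finset.mem_union_right _ h),
      ← Finset.sum_subset (f := base x) (Finset.subset_union_left (s₁ := S)) fun v _ hv =>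
        by_contra fun h => hbase_ne x hx v h (hS x hx v hv)]
    simp only [lost]
    ring
  have hjoin : ∀ x ∈ T, mX x ≠ 0 → mY x ≠ 0 → ∃ σ ∈ K, (∀ v, χ x v ≠ 0 → v ∈ σ) ∧
      (∀ v, g x v ≠ 0 → v ∈ σ) ∧ ∀ v, α x v ≠ 0 → v ∈ X ∩ Y := by
    intro x hx hX hY
    obtain ⟨R, -, hR⟩ := (hχ.3 x hx).exists_support
    obtain ⟨v, hv, hv0⟩ := Finset.exists_ne_zero_of_sum_ne_zero hX
    obtain ⟨v', hv', hv0'⟩ := Finset.exists_ne_zero_of_sum_ne_zero hY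
    obtain ⟨σ, hσ, hRσ, hασ⟩ := hχα x hx R (fun v hv => (hR v).1 hv)
      ⟨v, (hR v).2 hv0, (Finset.mem_filter.1 hv).2⟩
      ⟨v', (hR v').2 hv0', (Finset.mem_filter.1 hv').2⟩
    refine ⟨σ, hσ, fun v hv => hRσ ((hR v).2 hv), fun v hv => ?_, fun v hv => (hασ v hv).1⟩
    by_cases hb : base x v = 0
    · by_cases ha : α x v = 0
      · simp [g, hb, ha] at hv
      · exact (hασ v ha).2
    · exact hRσ ((hR v).2 (hbase_ne x hx v hb))
  have hgK : ∀ x ∈ T, ∃ σ ∈ K, (∀ v, χ x v ≠ 0 → v ∈ σ) ∧ ∀ v, g x v ≠ 0 → v ∈ σ := by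
    intro x hx
    by_cases h : mX x = 0 ∨ mY x = 0
    · rw [hgdeg x hx h]
      obtain ⟨R, hRK, hR⟩ := (hχ.3 x hx).exists_support
      exact ⟨R, hRK, fun v => (hR v).2, fun v => (hR v).2⟩
    · rw [not_or] at h
      obtain ⟨σ, hσ, h1, h2, -⟩ := hjoin x hx h.1 h.2
      exact ⟨σ, hσ, h1, h2⟩
  have hgP : ∀ x ∈ T, K.IsPoint (g x) := fun x hx => by
    obtain ⟨σ, hσ, -, h2⟩ := hgK x hx
    exact IsPoint.of_sum_eq_one (hg0 x hx) (hgS x hx) (hgsum x hx) hσ h2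
  have hsupp : ∀ x ∈ T, (∀ v, g x v ≠ 0 → v ∈ X) ∨ ∀ v, g x v ≠ 0 → v ∈ Y := by
    intro x hx
    by_contra! hcon
    obtain ⟨⟨v, hv, hvX⟩, v', hv', hvY⟩ := hcon
    by_cases h : mX x = 0 ∨ mY x = 0
    · rw [hgdeg x hx h] at hv hv'
      rcases h with h | h
      · exact hv' (le_antisymm (h ▸ hmX x hx v' hvY) ((hχ.3 x hx).1 v'))
      · exact hv (le_antisymm (h ▸ hmY x hx v hvX) ((hχ.3 x hx).1 v))
    · rw [not_or] at h
      obtain ⟨-, -, -, -, hα'⟩ := hjoin x hx h.1 h.2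
      have ha : α x v = 0 := by_contra fun h => hvX (hα' v h).1
      have ha' : α x v' = 0 := by_contra fun h => hvY (hα' v' h).2
      simp only [g, ha, ha', mul_zero, add_zero] at hv hv'
      have hvY' : v ∈ Y := (hmem x hx v (hbase_ne x hx v hv)).resolve_left hvX
      simp only [base, hvY, hvY', hvX, not_true_eq_false, not_false_eq_true, if_true,
        if_false] at hv hv'
      have h1 : 0 < χ x v - mX x := by
        by_contra! h; exact hv (max_eq_left h)
      have h2 : 0 < χ x v' - mY x := by
        by_contra! h; exact hv' (max_eq_left h)
      -- Survivors on both sides would give `χ v > mX ≥ χ v' > mY ≥ χ v`.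
      linarith [hmX x hx v' hvY, hmY x hx v hvX]
  refine ⟨g, ⟨⟨S ∪ S', hgS⟩, fun v => ?_, fun x hx => ?_⟩, fun x hx => ⟨hgK x hx, fun h => ?_⟩⟩
  · have hcX : ContinuousOn mX T := continuousOn_finsetSum _ fun v _ => hχ.2 v
    have hcY : ContinuousOn mY T := continuousOn_finsetSum _ fun v _ => hχ.2 v
    have hcb : ∀ v, ContinuousOn (fun x => base x v) T := by
      intro v
      simp only [base]
      split_ifs
      exacts [hχ.2 v, continuousOn_const.sup ((hχ.2 v).sub hcX),
        continuousOn_const.sup ((hχ.2 v).sub hcY)]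
    exact (hcb v).add ((continuousOn_const.sub (continuousOn_finsetSum _ fun v _ => hcb v)).mul
      (hα.2 v))
  · rcases hsupp x hx with h | h
    · exact ((hgP x hx).restriction h).mono le_sup_left
    · exact ((hgP x hx).restriction h).mono le_sup_right
  · refine hgdeg x hx ?_
    rcases h.mem_or_mem_of_sup with h | h
    · exact Or.inr (Finset.sum_eq_zero fun v hv =>
        by_contra fun h0 => (Finset.mem_filter.1 hv).2 (h v h0))
    · exact Or.inl (Finset.sum_eq_zero fun v hv =>
        by_contra fun h0 => (Finset.mem_filter.1 hv).2 (h v h0))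

/-- Maps of compact sets of dimension at most `n + 1` to `|K|` are deformed to maps to
`|K_X ∪ K_Y|`, and points that are in `|K_X ∪ K_Y|` stay there. -/
theorem IsMapOn.exists_deformation {X Y : Set U} (hXY : X ∪ Y = K.vertexSet) {n : ℕ}
    (hSt : ∀ σ ∈ K.skeleton (n + 1), σ ∉ K.decompositionPoset X Y →
      IsNConnected n (K.obstruction σ (X ∩ Y)).Realization)
    {j : ℕ} (hj : j ≤ n + 1) {T : Set (Fin j → ℝ)} (hT : IsCompact T)
    {φ : (Fin j → ℝ) → U → ℝ} (hφ : K.IsMapOn T φ) :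
    ∃ Φ : (Fin j → ℝ) × ℝ → U → ℝ, K.IsMapOn (T ×ˢ Icc 0 1) Φ ∧ ∀ x ∈ T, Φ (x, 0) = φ x ∧
      (K.restriction X ⊔ K.restriction Y).IsPoint (Φ (x, 1)) ∧
      ((K.restriction X ⊔ K.restriction Y).IsPoint (φ x) → ∀ s ∈ Icc (0 : ℝ) 1,
        (K.restriction X ⊔ K.restriction Y).IsPoint (Φ (x, s))) := by
  set L := K.restriction X ⊔ K.restriction Y
  have hLK : L ≤ K := K.restriction_sup_restriction_le X Y
  obtain ⟨ψ, hψ, hψφ⟩ := hφ.exists_skeletal hT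
  have hcard : ∀ x ∈ T, ∀ R : Finset U, (∀ v ∈ R, ψ x v ≠ 0) → R.card ≤ n + 2 :=
    fun x hx R hR => ((hψφ x hx).2 R hR).trans (by omega)
  obtain ⟨δ, hδ, hm⟩ : ∃ δ : ℝ, 0 < δ ∧ ((n + 2 : ℕ) : ℝ) * δ < 1 :=
    ⟨((n + 3 : ℕ) : ℝ)⁻¹, by positivity, by
      rw [← div_eq_mul_inv, div_lt_one (by positivity)]; push_cast; linarith⟩
  obtain ⟨χ, hχ, hχψ⟩ := hψ.exists_threshold hδ hm hcard
  obtain ⟨α, hα, hαψ⟩ := hψ.exists_joinable hSt hj hT hδ hcard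
  obtain ⟨g, hg, hgχ⟩ := hχ.exists_push hXY hα fun x hx R hR =>
    hαψ x hx R fun v hv => hχψ x hx v (hR v hv)
  have hχφ : ∀ x ∈ T, ∀ v, χ x v ≠ 0 → φ x v ≠ 0 := fun x hx v hv =>
    (hψφ x hx).1 v (hδ.trans_le (hχψ x hx v hv)).ne'
  let r₁ : (Fin j → ℝ) × ℝ → ℝ := fun z => 2 * z.2
  let r₂ : (Fin j → ℝ) × ℝ → ℝ := fun z => 2 * z.2 - 1
  let Φ₁ : (Fin j → ℝ) × ℝ → U → ℝ := fun z v => (1 - r₁ z) * φ z.1 v + r₁ z * χ z.1 v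
  let Φ₂ : (Fin j → ℝ) × ℝ → U → ℝ := fun z v => (1 - r₂ z) * χ z.1 v + r₂ z * g z.1 v
  have hr₁ : ∀ z ∈ T ×ˢ Icc (0 : ℝ) (1 / 2), r₁ z ∈ Icc (0 : ℝ) 1 := fun z hz => by
    have := hz.2; constructor <;> simp only [r₁] <;> linarith [this.1, this.2]
  have hr₂ : ∀ z ∈ T ×ˢ Icc (1 / 2 : ℝ) 1, r₂ z ∈ Icc (0 : ℝ) 1 := fun z hz => by
    have := hz.2; constructor <;> simp only [r₂] <;> linarith [this.1, this.2]
  have hΦ₁ : K.IsMapOn (T ×ˢ Icc (0 : ℝ) (1 / 2)) Φ₁ := by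
    refine (hφ.comp continuousOn_fst fun z hz => hz.1).combo
      (hχ.comp continuousOn_fst fun z hz => hz.1) (by fun_prop) hr₁ fun z hz => ?_
    obtain ⟨σ, hσ, h⟩ := (hφ.3 z.1 hz.1).exists_support
    exact ⟨σ, hσ, fun v hv => (h v).2 hv, fun v hv => (h v).2 (hχφ z.1 hz.1 v hv)⟩
  have hΦ₂ : K.IsMapOn (T ×ˢ Icc (1 / 2 : ℝ) 1) Φ₂ :=
    (hχ.comp continuousOn_fst fun z hz => hz.1).combo
      (hg.comp continuousOn_fst fun z hz => hz.1) (by fun_prop) hr₂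
      fun z hz => (hgχ z.1 hz.1).1
  classical
  -- In the first half supports only shrink, so points of `|L|` stay in `|L|`; in the second half
  -- such points are stationary.
  let Φ : (Fin j → ℝ) × ℝ → U → ℝ := fun z => if z.2 ≤ 1 / 2 then Φ₁ z else Φ₂ z
  have hΦeq₁ : ∀ z ∈ T ×ˢ Icc (0 : ℝ) (1 / 2), Φ z = Φ₁ z := fun z hz => if_pos hz.2.2
  have hΦeq₂ : ∀ z ∈ T ×ˢ Icc (1 / 2 : ℝ) 1, Φ z = Φ₂ z := by
    rintro ⟨x, s⟩ hz
    rcases hz.2.1.lt_or_eq with h | h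
    · exact if_neg (not_le.2 h)
    · have h' : s = 1 / 2 := h.symm
      subst h'
      funext v
      simp [Φ, Φ₁, Φ₂, r₁, r₂]
  refine ⟨Φ, ((hΦ₁.congr hΦeq₁).union (hΦ₂.congr hΦeq₂) (hT.isClosed.prod isClosed_Icc)
    (hT.isClosed.prod isClosed_Icc)).subset ?_, fun x hx => ⟨?_, ?_, fun hL s hs => ?_⟩⟩
  · rintro z ⟨hz1, hz2⟩
    rcases le_total z.2 (1 / 2) with h | h
    · exact Or.inl ⟨hz1, hz2.1, h⟩
    · exact Or.inr ⟨hz1, h, hz2.2⟩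
  · funext v
    simp [Φ, Φ₁, r₁]
  · convert hg.3 x hx using 1
    funext v
    norm_num [Φ, Φ₂, r₂]
  · have hLχ : L.IsPoint (χ x) := hL.of_support_subset (hχ.3 x hx) (hχφ x hx)
    rcases le_total s (1 / 2) with h | h
    · have hz : (x, s) ∈ T ×ˢ Icc (0 : ℝ) (1 / 2) := ⟨hx, hs.1, h⟩
      rw [hΦeq₁ _ hz]
      obtain ⟨σ, hσ, h⟩ := hL.exists_support
      exact hL.combo hLχ hσ (fun v hv => (h v).2 hv) (fun v hv => (h v).2 (hχφ x hx v hv))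
        (hr₁ _ hz)
    · have hz : (x, s) ∈ T ×ˢ Icc (1 / 2 : ℝ) 1 := ⟨hx, h, hs.2⟩
      rw [hΦeq₂ _ hz]
      convert hLχ using 1
      funext v
      simp only [Φ₂, (hgχ x hx).2 hLχ]
      ring

/-- Extension over `ball × [0, 1]` of a map that is given on the top and on the sides, so that the
bottom is mapped to `|K_X ∪ K_Y|`. -/
theorem IsMapOn.exists_extension_prism {X Y : Set U} (hXY : X ∪ Y = K.vertexSet) {n : ℕ}
    (hSt : ∀ σ ∈ K.skeleton (n + 1), σ ∉ K.decompositionPoset X Y →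
      IsNConnected n (K.obstruction σ (X ∩ Y)).Realization)
    {j : ℕ} (hj : j ≤ n + 1) {φ : (Fin j → ℝ) → U → ℝ}
    (hφ : K.IsMapOn (Metric.closedBall 0 1) φ)
    (hL : ∀ y, ‖y‖ = 1 → (K.restriction X ⊔ K.restriction Y).IsPoint (φ y)) :
    ∃ G : (Fin j → ℝ) × ℝ → U → ℝ, K.IsMapOn (Metric.closedBall 0 1 ×ˢ Icc 0 1) G ∧
      (∀ y, ‖y‖ ≤ 1 → (K.restriction X ⊔ K.restriction Y).IsPoint (G (y, 0))) ∧
      (∀ y, ‖y‖ ≤ 1 → G (y, 1) = φ ((1 + (1 : ℝ))⁻¹ • y)) ∧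
      ∀ y, ‖y‖ = 1 → ∀ t ∈ Icc (0 : ℝ) 1, G (y, t) = φ ((1 + t)⁻¹ • y) := by
  obtain ⟨Φ, hΦ, h⟩ := hφ.exists_deformation hXY hSt hj (isCompact_closedBall 0 1)
  -- `N = 1` on the top and the sides; there `θ (y, t) = ((1 + t)⁻¹ • y, 0)`, where `Φ` is `φ`. On
  -- the bottom, `‖y‖ ≤ 1/2` gives deformation time `1`, and `‖y‖ ≥ 1/2` gives a point of the unit
  -- sphere, whose track stays in `|K_X ∪ K_Y|`. The `1/2` in `D` keeps the denominator positive.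
  let N : (Fin j → ℝ) × ℝ → ℝ := fun z => max ‖z.1‖ z.2
  let D : (Fin j → ℝ) × ℝ → ℝ := fun z => max (N z) (1 / 2) + z.2
  let θ : (Fin j → ℝ) × ℝ → (Fin j → ℝ) × ℝ := fun z =>
    ((D z)⁻¹ • z.1, max 0 (min 1 (2 - 2 * N z)))
  have hD : ∀ z ∈ Metric.closedBall (0 : Fin j → ℝ) 1 ×ˢ Icc (0 : ℝ) 1, 0 < D z := fun z hz => by
    have h1 : (1 / 2 : ℝ) ≤ max (N z) (1 / 2) := le_max_right _ _
    have h2 := hz.2.1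
    simp only [D]
    linarith
  have hND : ∀ z ∈ Metric.closedBall (0 : Fin j → ℝ) 1 ×ˢ Icc (0 : ℝ) 1, ‖z.1‖ ≤ D z :=
    fun z hz => by
      have h1 : N z ≤ max (N z) (1 / 2) := le_max_left _ _
      have h2 := hz.2.1
      have h3 : ‖z.1‖ ≤ N z := le_max_left _ _
      simp only [D]
      linarith
  have hθm : MapsTo θ (Metric.closedBall 0 1 ×ˢ Icc 0 1) (Metric.closedBall 0 1 ×ˢ Icc 0 1) := by
    intro z hz
    refine ⟨?_, le_max_left _ _, max_le zero_le_one (min_le_left _ _)⟩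
    rw [mem_closedBall_zero_iff, norm_smul, Real.norm_of_nonneg (inv_nonneg.2 (hD z hz).le),
      inv_mul_le_iff₀ (hD z hz), mul_one]
    exact hND z hz
  have hθc : ContinuousOn θ (Metric.closedBall 0 1 ×ˢ Icc 0 1) := by
    have hN : Continuous N := by fun_prop
    have hDc : Continuous D := by fun_prop
    exact ((hDc.continuousOn.inv₀ fun z hz => (hD z hz).ne').smul continuousOn_fst).prodMk
      (by fun_prop)
  have hball : ∀ {y : Fin j → ℝ}, ‖y‖ ≤ 1 → y ∈ Metric.closedBall (0 : Fin j → ℝ) 1 :=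
    fun hy => mem_closedBall_zero_iff.2 hy
  have hN1 : ∀ y, ‖y‖ ≤ 1 → ∀ t ∈ Icc (0 : ℝ) 1, N (y, t) = 1 →
      Φ (θ (y, t)) = φ ((1 + t)⁻¹ • y) := by
    intro y hy t ht hN
    have h1 : θ (y, t) = ((1 + t)⁻¹ • y, 0) := by
      simp only [θ, D, hN]
      norm_num
    rw [h1]
    have h2 := hθm (x := (y, t)) ⟨hball hy, ht⟩
    rw [h1] at h2
    exact (h _ h2.1).1
  refine ⟨fun z => Φ (θ z), hΦ.comp hθc hθm, fun y hy => ?_, fun y hy => ?_, fun y hy t ht => ?_⟩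
  · have hz : (y, (0 : ℝ)) ∈ Metric.closedBall (0 : Fin j → ℝ) 1 ×ˢ Icc (0 : ℝ) 1 :=
      ⟨hball hy, le_rfl, zero_le_one⟩
    have hmem := hθm hz
    have hN : N (y, 0) = ‖y‖ := max_eq_left (norm_nonneg y)
    rcases le_total ‖y‖ (1 / 2) with h0 | h0
    · have : (θ (y, 0)).2 = 1 := by
        simp only [θ, hN]
        rw [min_eq_left (by linarith), max_eq_right zero_le_one]
      have h1 := (h _ hmem.1).2.1
      rwa [← this] at h1
    · have hn : ‖(θ (y, 0)).1‖ = 1 := by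
        have : D (y, 0) = ‖y‖ := by simp only [D, hN, add_zero]; exact max_eq_left h0
        simp only [θ, this]
        rw [norm_smul, norm_inv, norm_norm, inv_mul_cancel₀ (by linarith)]
      exact (h _ hmem.1).2.2 (hL _ hn) _ hmem.2
  · exact hN1 y hy 1 ⟨zero_le_one, le_rfl⟩ (max_eq_right hy)
  · exact hN1 y hy.le t ht (by simp only [N, hy]; exact max_eq_left ht.2)

end PreAbstractSimplicialComplex

end

/-! ### Maps to the homotopy fiber and contraction of its loops. -/

section

open Set Topology unitInterval

namespace PreAbstractSimplicialComplex

variable {U : Type*} {K L : PreAbstractSimplicialComplex U}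

/-- The path determines the point of `|L|`: its start has the same coordinates. -/
theorem homotopyFiber_ext (h : L ≤ K) {b : K.Realization}
    {z z' : HomotopyFiber (realizationInclusion h) b}
    (hz : ∀ t, (z.1.2 t).coord = (z'.1.2 t).coord) : z = z' := by
  have h2 : z.1.2 = z'.1.2 := ContinuousMap.ext fun t => Realization.ext (hz t)
  refine Subtype.ext (Prod.ext (Realization.ext ?_) h2)
  have h1 := z.2.1
  rw [h2, z'.2.1] at h1
  exact (congrArg Realization.coord h1.symm :
    (realizationInclusion h z.1.1).coord = (realizationInclusion h z'.1.1).coord)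

/-- Continuous maps to the homotopy fiber of `|L| → |K|` in coordinates. -/
theorem exists_map_homotopyFiber (h : L ≤ K) (b : K.Realization) {W : Type*} [TopologicalSpace W]
    {f : W × I → U → ℝ} (hf : K.IsMapOn univ f) (hf0 : ∀ w, L.IsPoint (f (w, 0)))
    (hf1 : ∀ w, f (w, 1) = b.coord) :
    ∃ Γ : C(W, HomotopyFiber (realizationInclusion h) b),
      ∀ w t, ((Γ w).1.2 t).coord = f (w, t) := by
  choose a ha using fun w => isPoint_coord (hf0 w)
  choose p hp using fun w => isPoint_coord (hf.3 w (mem_univ w))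
  have hac : Continuous a := by
    rw [← continuousOn_univ]
    refine IsMapOn.continuousOn_realization (f := fun w => f (w, 0)) ?_ fun w _ => ha w
    exact (hf.comp (t := univ) (φ := fun w => (w, (0 : I))) (by fun_prop)
      (mapsTo_univ _ _)).change fun w _ => hf0 w
  have hpc : Continuous p := by
    rw [← continuousOn_univ]
    exact hf.continuousOn_realization fun w _ => hp w
  let P : C(W × I, K.Realization) := ⟨p, hpc⟩
  refine ⟨⟨fun w => ⟨(a w, P.curry w), Realization.ext ?_, Realization.ext ?_⟩, ?_⟩,
    fun w t => hp (w, t)⟩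
  · exact (hp (w, 0)).trans (ha w).symm
  · exact (hp (w, 1)).trans (hf1 w)
  · exact (hac.prodMk P.curry.continuous).subtype_mk _

section Loop

variable {i : ℕ}

/-- The coordinates in `[0, 1]ⁱ` of a point of `ℝ × [-1, 1]ⁱ`. -/
noncomputable def cubePart (y : Fin (i + 1) → ℝ) : Fin i → I := fun m =>
  projIcc 0 1 zero_le_one ((y m.succ + 1) / 2)

theorem continuous_cubePart : Continuous (cubePart (i := i)) :=
  continuous_pi fun m => continuous_projIcc.comp (by fun_prop)

theorem cubePart_cons (s : ℝ) (x : Fin i → I) : cubePart (Fin.cons s (cubeCenter x)) = x := by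
  funext m
  have h : ((Fin.cons s (cubeCenter x) : Fin (i + 1) → ℝ) m.succ + 1) / 2 = x m := by
    simp [cubeCenter]
  rw [cubePart, h, projIcc_val]

theorem cubePart_mem_boundary {y : Fin (i + 1) → ℝ} {m : Fin i} (h : |y m.succ| = 1) :
    cubePart y ∈ Cube.boundary (Fin i) := by
  refine ⟨m, ?_⟩
  rcases (abs_eq zero_le_one).1 h with h | h
  · right; simp [cubePart, h]
  · left; simp [cubePart, h]

theorem norm_cons_cubeCenter_le (s : I) (x : Fin i → I) :
    ‖(Fin.cons (2 * (s : ℝ) - 1) (cubeCenter x) : Fin (i + 1) → ℝ)‖ ≤ 1 := by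
  refine (pi_norm_le_iff_of_nonneg zero_le_one).2 fun m => ?_
  refine Fin.cases ?_ (fun m => ?_) m
  · rw [Fin.cons_zero, Real.norm_eq_abs, abs_le]
    constructor <;> linarith [s.2.1, s.2.2]
  · rw [Fin.cons_succ]
    exact (norm_le_pi_norm _ m).trans (norm_cubeCenter_le x)

theorem norm_cons_cubeCenter_eq {s : I} {x : Fin i → I}
    (h : s = 0 ∨ s = 1 ∨ x ∈ Cube.boundary (Fin i)) :
    ‖(Fin.cons (2 * (s : ℝ) - 1) (cubeCenter x) : Fin (i + 1) → ℝ)‖ = 1 := by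
  refine le_antisymm (norm_cons_cubeCenter_le s x) ?_
  set y : Fin (i + 1) → ℝ := Fin.cons (2 * (s : ℝ) - 1) (cubeCenter x) with hy
  rcases h with rfl | rfl | h
  · simpa [hy] using norm_le_pi_norm y 0
  · refine le_trans ?_ (norm_le_pi_norm y 0)
    norm_num [hy]
  · rw [← norm_cubeCenter_eq_one.2 h]
    refine (pi_norm_le_iff_of_nonneg (norm_nonneg _)).2 fun m => ?_
    simpa [hy] using norm_le_pi_norm y m.succ

/-- The map of the `(i + 1)`-ball described by a map `f` on `[0, 1]ⁱ × [0, 1]` and a path `γ`: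
in coordinates `(s, x, t)`, with `s ∈ [-1, 1]`, it is `f` on the face `s = -1` and `γ t` on the
other sides and on the top of a prism. -/
noncomputable def prismMap (f : (Fin i → I) × I → U → ℝ) (γ : I → U → ℝ)
    (y : Fin (i + 1) → ℝ) : U → ℝ :=
  open Classical in
  if (max ‖y‖ (1 / 2))⁻¹ * y 0 = -1 then
    f (cubePart ((max ‖y‖ (1 / 2))⁻¹ • y), projIcc 0 1 zero_le_one ((max ‖y‖ (1 / 2))⁻¹ - 1))
  else γ (projIcc 0 1 zero_le_one ((max ‖y‖ (1 / 2))⁻¹ - 1))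

variable {f : (Fin i → I) × I → U → ℝ} {γ : I → U → ℝ}

-- On the sides and on the top, `max ‖·‖ (1/2)` at `(1 + t)⁻¹ • y` recovers `(1 + t)⁻¹`, so
-- `prismMap` undoes the parametrization used in `exists_extension_prism`.
open Classical in
theorem prismMap_smul {y : Fin (i + 1) → ℝ} (hy : ‖y‖ ≤ 1) {t : I} (h : ‖y‖ = 1 ∨ t = 1) :
    prismMap f γ ((1 + (t : ℝ))⁻¹ • y) = if y 0 = -1 then f (cubePart y, t) else γ t := by
  have ht : (0 : ℝ) < 1 + t := by linarith [t.2.1]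
  have hμ : max ‖(1 + (t : ℝ))⁻¹ • y‖ (1 / 2) = (1 + (t : ℝ))⁻¹ := by
    rw [norm_smul, Real.norm_of_nonneg (inv_nonneg.2 ht.le)]
    rcases h with h | rfl
    · rw [h, mul_one, max_eq_left]
      rw [one_div]
      exact inv_anti₀ ht (by linarith [t.2.2])
    · rw [Set.Icc.coe_one, max_eq_right]
      · norm_num
      · linarith
  have h1 : (1 + (t : ℝ)) • (1 + (t : ℝ))⁻¹ • y = y := smul_inv_smul₀ ht.ne' y
  have h2 : (1 + (t : ℝ)) * ((1 + (t : ℝ))⁻¹ • y) 0 = y 0 := congrFun h1 0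
  have h3 : projIcc (0 : ℝ) 1 zero_le_one (1 + (t : ℝ) - 1) = t := by
    rw [add_sub_cancel_left, projIcc_val]
  simp only [prismMap, hμ, inv_inv, h1, h2, h3]

/-- The face `s = -1` and the union of the top with the other sides are closed and cover the ball.
They overlap only where `t = 1` or `x` is in the boundary of the cube, and there `f` and `γ` agree.
-/
theorem isMapOn_prismMap (hf : K.IsMapOn univ f) (hγ : K.IsMapOn univ γ)
    (hf1 : ∀ x, f (x, 1) = γ 1) (hfb : ∀ x ∈ Cube.boundary (Fin i), ∀ t, f (x, t) = γ t) :
    K.IsMapOn (Metric.closedBall 0 1) (prismMap f γ) := by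
  classical
  let μ : (Fin (i + 1) → ℝ) → ℝ := fun y => max ‖y‖ (1 / 2)
  let y' : (Fin (i + 1) → ℝ) → Fin (i + 1) → ℝ := fun y => (μ y)⁻¹ • y
  let t' : (Fin (i + 1) → ℝ) → I := fun y => projIcc 0 1 zero_le_one ((μ y)⁻¹ - 1)
  have hμ0 : ∀ y, μ y ≠ 0 := fun y => (lt_of_lt_of_le (by norm_num) (le_max_right _ _)).ne'
  have hμ : Continuous μ := by fun_prop
  have hy' : Continuous y' := (hμ.inv₀ hμ0).smul continuous_id
  have ht' : Continuous t' := continuous_projIcc.comp ((hμ.inv₀ hμ0).sub continuous_const)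
  let C₁ : Set (Fin (i + 1) → ℝ) := {y | y' y 0 = -1}
  let C₂ : Set (Fin (i + 1) → ℝ) := {y | t' y = 1} ∪ {y | y' y 0 = 1} ∪
    ⋃ m : Fin i, {y | |y' y m.succ| = 1}
  have hC₁ : IsClosed C₁ := isClosed_eq ((continuous_apply 0).comp hy') continuous_const
  have hC₂ : IsClosed C₂ :=
    ((isClosed_eq ht' continuous_const).union
      (isClosed_eq ((continuous_apply 0).comp hy') continuous_const)).union
      (isClosed_iUnion_of_finite fun m =>
        isClosed_eq ((continuous_apply m.succ).comp hy').abs continuous_const)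
  have h₁ : K.IsMapOn C₁ (prismMap f γ) :=
    (hf.comp (φ := fun y => (cubePart (y' y), t' y))
      ((continuous_cubePart.comp hy').prodMk ht').continuousOn (mapsTo_univ _ _)).congr
      fun y hy => if_pos hy
  have h₂ : K.IsMapOn C₂ (prismMap f γ) := by
    refine (hγ.comp ht'.continuousOn (mapsTo_univ _ C₂)).congr fun y hy => ?_
    by_cases h : y' y 0 = -1
    · refine (if_pos h).trans ?_
      change f (cubePart (y' y), t' y) = γ (t' y)
      rcases hy with (hy | hy) | hy
      · rw [mem_ofPred_eq] at hy
        rw [hy, hf1]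
      · rw [mem_ofPred_eq, h] at hy
        norm_num at hy
      · obtain ⟨m, hm⟩ := mem_iUnion.1 hy
        exact hfb _ (cubePart_mem_boundary hm) _
    · exact if_neg h
  refine (h₁.union h₂ hC₁ hC₂).subset fun y hy => ?_
  by_contra hcon
  simp only [C₁, C₂, mem_union, mem_iUnion, mem_ofPred_eq, not_or, not_exists] at hcon
  obtain ⟨hc1, ⟨hc2, hc3⟩, hc4⟩ := hcon
  rcases le_total ‖y‖ (1 / 2) with h | h
  · refine hc2 ?_
    simp only [t', μ, max_eq_right h]
    exact projIcc_of_right_le _ (by norm_num)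
  · have hn : ‖y' y‖ = 1 := by
      have : μ y = ‖y‖ := max_eq_left h
      simp only [y', this]
      rw [norm_smul, norm_inv, norm_norm, inv_mul_cancel₀ (by linarith)]
    refine absurd hn (ne_of_lt ((pi_norm_lt_iff zero_lt_one).2 fun m => ?_))
    refine lt_of_le_of_ne (hn ▸ norm_le_pi_norm (y' y) m) ?_
    rw [Real.norm_eq_abs]
    refine Fin.cases (fun h => ?_) (fun m => hc4 m) m
    exact ((abs_eq zero_le_one).1 h).elim hc3 hc1

end Loop

/-- The homotopy fibers of `|K_X ∪ K_Y| → |K|` are `n`-connected. -/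
theorem isNConnected_homotopyFiber {X Y : Set U} (hXY : X ∪ Y = K.vertexSet) {n : ℕ}
    (hSt : ∀ τ ∈ K.skeleton (n + 1), τ ∉ K.decompositionPoset X Y →
      IsNConnected n (K.obstruction τ (X ∩ Y)).Realization) (b : K.Realization) :
    IsNConnected n (HomotopyFiber (realizationInclusion
      (K.restriction_sup_restriction_le X Y)) b) := by
  set L := K.restriction X ⊔ K.restriction Y
  have hLK : L ≤ K := K.restriction_sup_restriction_le X Y
  constructor
  -- For nonemptiness the ball of `ℝ⁰` is a point with empty sphere; the prism over it is a path
  -- from `|L|` to `b`.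
  · have hφ : K.IsMapOn (Metric.closedBall (0 : Fin 0 → ℝ) 1) fun _ => b.coord :=
      isMapOn_coord (isCompact_closedBall 0 1) (φ := fun _ => b) continuousOn_const
    obtain ⟨G, hG, hG0, hG1, -⟩ := hφ.exists_extension_prism hXY hSt (Nat.zero_le _)
      fun y hy => by
        rw [Subsingleton.elim y 0, norm_zero] at hy
        exact absurd hy zero_ne_one
    obtain ⟨Γ, -⟩ := exists_map_homotopyFiber hLK b (W := Unit)
      (f := fun w => G (0, (w.2 : ℝ)))
      (hG.comp (by fun_prop) fun w _ => ⟨by simp, w.2.2⟩)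
      (fun _ => hG0 0 (norm_zero.trans_le zero_le_one))
      (fun _ => hG1 0 (norm_zero.trans_le zero_le_one))
    exact ⟨Γ ()⟩
  · intro i hi z
    have key : ∀ g : GenLoop (Fin i) (HomotopyFiber (realizationInclusion hLK) b) z,
        GenLoop.Homotopic g GenLoop.const := by
      intro g
      let f : (Fin i → I) × I → U → ℝ := fun w => ((g w.1).1.2 w.2).coord
      let γ : I → U → ℝ := fun t => (z.1.2 t).coord
      have hf : K.IsMapOn univ f := isMapOn_coord isCompact_univ
        (φ := fun w : (Fin i → I) × I => (g w.1).1.2 w.2) (by fun_prop)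
      have hγ : K.IsMapOn univ γ := isMapOn_coord isCompact_univ
        (φ := fun t => z.1.2 t) (by fun_prop)
      have hf1 : ∀ x, f (x, 1) = b.coord := fun x => congrArg Realization.coord (g x).2.2
      have hγ1 : γ 1 = b.coord := congrArg Realization.coord z.2.2
      have hfb : ∀ x ∈ Cube.boundary (Fin i), ∀ t, f (x, t) = γ t := fun x hx t => by
        simp only [f, γ]
        rw [show g x = z from g.2 x hx]
      have hf0 : ∀ x, L.IsPoint (f (x, 0)) := fun x => by
        simp only [f, (g x).2.1]
        exact (g x).1.1.isPoint
      have hγ0 : L.IsPoint (γ 0) := by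
        simp only [γ, z.2.1]
        exact z.1.1.isPoint
      have hφ := isMapOn_prismMap hf hγ (fun x => (hf1 x).trans hγ1.symm) hfb
      obtain ⟨G, hG, hG0, hG1, hGs⟩ := hφ.exists_extension_prism hXY hSt
        (Nat.succ_le_succ hi) fun y hy => by
          have := prismMap_smul (f := f) (γ := γ) hy.le (t := 0) (Or.inl hy)
          rw [Set.Icc.coe_zero, add_zero, inv_one, one_smul] at this
          rw [this]
          split_ifs
          exacts [hf0 _, hγ0]
      -- Homotopy parameter and cube together form the sup-norm unit ball of `ℝⁱ⁺¹`, with `i + 1 ≤ n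
      -- + 1`. Its face `s = 0` carries `g`, and the rest of its boundary carries the base point
      -- `z`.
      let y : I × (Fin i → I) → Fin (i + 1) → ℝ := fun a =>
        Fin.cons (2 * (a.1 : ℝ) - 1) (cubeCenter a.2)
      have hy : Continuous y := by
        refine continuous_pi fun m => Fin.cases ?_ (fun m => ?_) m
        · simp only [y, Fin.cons_zero]; fun_prop
        · simp only [y, Fin.cons_succ]
          exact (continuous_apply m).comp (continuous_cubeCenter.comp continuous_snd)
      have hy1 : ∀ a, ‖y a‖ ≤ 1 := fun a => norm_cons_cubeCenter_le a.1 a.2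
      obtain ⟨Γ, hΓ⟩ := exists_map_homotopyFiber hLK b (W := I × (Fin i → I))
        (f := fun w => G (y w.1, (w.2 : ℝ)))
        (hG.comp (φ := fun w : (I × (Fin i → I)) × I => (y w.1, (w.2 : ℝ)))
          ((hy.comp continuous_fst).prodMk (by fun_prop)).continuousOn
          fun w _ => ⟨by simpa using hy1 w.1, w.2.2⟩)
        (fun w => hG0 _ (hy1 w)) (fun w => by
          have := prismMap_smul (f := f) (γ := γ) (hy1 w) (t := 1) (Or.inr rfl)
          rw [Set.Icc.coe_one] at this
          rw [Set.Icc.coe_one, hG1 _ (hy1 w), this]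
          split_ifs
          exacts [hf1 _, hγ1])
      have hΓs : ∀ (s : I) (x : Fin i → I) (t : I),
          s = 0 ∨ s = 1 ∨ x ∈ Cube.boundary (Fin i) → ((Γ (s, x)).1.2 t).coord =
            if 2 * (s : ℝ) - 1 = -1 then f (x, t) else γ t := by
        intro s x t h
        have hn : ‖y (s, x)‖ = 1 := norm_cons_cubeCenter_eq h
        rw [hΓ, hGs _ hn _ t.2, prismMap_smul hn.le (Or.inl hn)]
        simp only [y, Fin.cons_zero, cubePart_cons]
      have hΓ0 : ∀ x, Γ (0, x) = g x := fun x => homotopyFiber_ext hLK fun t => by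
        rw [hΓs 0 x t (Or.inl rfl), if_pos (by simp)]
      have hΓ1 : ∀ x, Γ (1, x) = z := fun x => homotopyFiber_ext hLK fun t => by
        rw [hΓs 1 x t (Or.inr (Or.inl rfl)), if_neg (by norm_num)]
      have hΓb : ∀ s, ∀ x ∈ Cube.boundary (Fin i), Γ (s, x) = z := fun s x hx =>
        homotopyFiber_ext hLK fun t => by
          rw [hΓs s x t (Or.inr (Or.inr hx)), hfb x hx t, ite_self]
      exact ⟨{ toContinuousMap := Γ
               map_zero_left := hΓ0
               map_one_left := hΓ1
               prop' := fun s x hx => (hΓb s x hx).trans (g.2 x hx).symm }⟩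
    refine ⟨fun p q => ?_⟩
    induction p using Quotient.inductionOn with
    | h p =>
    induction q using Quotient.inductionOn with
    | h q => exact Quotient.sound ((key p).trans (key q).symm)

end PreAbstractSimplicialComplex

end

theorem mainTheorem4 {U : Type*} (K : PreAbstractSimplicialComplex U) (X Y : Set U)
    (hXY : X ∪ Y = K.vertexSet) (n : ℕ)
    (hSt : ∀ σ ∈ K.skeleton (n + 1), σ ∉ K.decompositionPoset X Y →
      IsNConnected n (K.obstruction σ (X ∩ Y)).Realization) :
    ∀ b : K.Realization,
      IsNConnected n
        (HomotopyFiber (PreAbstractSimplicialComplex.realizationInclusion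
          (K.restriction_sup_restriction_le X Y)) b) := by
  exact PreAbstractSimplicialComplex.isNConnected_homotopyFiber hXY hSt
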